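/- Let $G$ be a finitely generated group with identity $e$, and let $q$ be a probability measure on a finite generating set of $G$ such that the random walk $S_n = X_1\cdots X_n$ with i.i.d. increments of law $q$ is irreducible: with $p^{(n)}(x,y)$ the probability that the walk goes from $x$ to $y$ in $n$ steps, for all $x,y\in G$ there is some $k$ with $p^{(k)}(x,y)>0$. Let $\rho(P)$ be the inverse of the radius of convergence of $\sum_n p^{(n)}(e,e)z^n$. Let $\mu$ be a probability distribution on $\{0,1,2,\dots\}$ with $\mu_0=0$ and mean $m=\sum_k k\mu_k\in(1,\infty]$, and let $\mathcal T$ be a Galton--Watson tree with offspring distribution $\mu$ and root $\mathbf r$; write $|v|$ for the distance of a vertex $v$ from the root. Independently of $\mathcal T$, attach to every vertex $v\neq\mathbf r$ (equivalently, to the edge that joins $v$ to its predecessor) i.i.d. samples $X_v^{(1)},X_v^{(2)},\dots$ of law $q$ and the points $0=\psi_v^{(0)}<\psi_v^{(1)}<\psi_v^{(2)}<\cdots$ of a rate-$1$ Poisson process, all samples and all Poisson processes being independent. For $t\ge 0$ put $X_v(t)=X_v^{(j)}$ if $\psi_v^{(j-1)}\le t<\psi_v^{(j)}$, and $S_v(t)=X_{v_1}(t)X_{v_2}(t)\cdots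 X_{v_n}(t)$, where $\mathbf r,v_1,\dots,v_n=v$ is the geodesic from the root to $v$. (The tree does not change with $t$.) Let $\mathbf P$ be the joint law of the tree, the samples and the Poisson processes. Then: (i) if $m\le 1/\rho(P)$ and $\sum_n n\,p^{(n)}(e,e)\,m^n<\infty$, then $$\mathbf P\Bigl(\sum_{n=1}^\infty\sum_{|v|=n}\mathbf 1\{S_v(t)=e\}<\infty\ \text{ for all } t\ge 0\Bigr)=1;$$ (ii) if $m>1/\rho(P)$, then $$\mathbf P\Bigl(\sum_{n=1}^\infty\sum_{|v|=n}\mathbf 1\{S_v(t)=e\}=\infty\ \text{ for all } t\ge 0\Bigr)=1.$$ -/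

import Mathlib

open MeasureTheory ProbabilityTheory
open scoped ENNReal

namespace DynBRW

noncomputable section

/-! ### Random walks on groups -/

/-- The law of `S_n = x X_1 ⋯ X_n`, where `X_1, X_2, …` are i.i.d. with law `q`. -/
def walkLaw {G : Type*} [Group G] (q : PMF G) (x : G) : ℕ → PMF G
  | 0 => PMF.pure x
  | n + 1 => (walkLaw q x n).bind fun z => q.map (fun g => z * g)

/-- The `n`-step transition probability `p^{(n)}(x, y)`. -/
def stepProb {G : Type*} [Group G] (q : PMF G) (n : ℕ) (x y : G) : ℝ≥0∞ :=
  walkLaw q x n y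

/-- Irreducibility: every state is reached from every state with positive probability. -/
def IsIrreducibleWalk {G : Type*} [Group G] (q : PMF G) : Prop :=
  ∀ x y : G, ∃ k : ℕ, 0 < stepProb q k x y

/-- The generating function `∑ₙ p^{(n)}(x, y) zⁿ`, as a power series. -/
def genFun {G : Type*} [Group G] (q : PMF G) (x y : G) : FormalMultilinearSeries ℝ ℝ ℝ :=
  FormalMultilinearSeries.ofScalars ℝ (fun n => (stepProb q n x y).toReal)

/-- The spectral radius `ρ(P)`: the inverse of the radius of convergence of the generating
function of the return probabilities to the identity. -/
def rho {G : Type*} [Group G] (q : PMF G) : ℝ≥0∞ :=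
  (genFun q 1 1).radius⁻¹

/-! ### Galton--Watson trees -/

/-- Vertices of the Ulam--Harris tree. The root is `[]`, and `i :: v` is the child number `i`
of `v`, so the predecessor of a vertex is its tail and `|v|` is `v.length`. -/
abbrev Vertex : Type := List ℕ

/-- The mean `∑ₖ k μₖ` of the offspring distribution `μ`, possibly infinite. -/
def offspringMean (μ : PMF ℕ) : ℝ≥0∞ :=
  ∑' k : ℕ, (k : ℝ≥0∞) * μ k

/-- The vertex set of the tree in which `v` has the children `i :: v` with `i < N v`. -/
def InTree (N : Vertex → ℕ) : Vertex → Prop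
  | [] => True
  | i :: v => InTree N v ∧ i < N v

/-! ### Dynamical tree-indexed random walks -/

/-- The value at time `t` of a variable with successive samples `x 1, x 2, …` that is refreshed
at the times `s 1 < s 2 < …` (with `s 0 = 0`): it is `x j` for the least `j` with `t < s j`,
that is, for `s (j - 1) ≤ t < s j`. -/
def refreshed {G : Type*} (x : ℕ → G) (s : ℕ → ℝ) (t : ℝ) : G :=
  x (sInf {j : ℕ | t < s j})

/-- The position `S_v(t)`: the product of the labels at time `t` of the edges on the geodesic
from the root to `v`. The label of the edge from the predecessor of `v` to `v` has the
samples `x v 1, x v 2, …` and the refreshing times `s v 1, s v 2, …`. -/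
def position {G : Type*} [Group G] (x : Vertex → ℕ → G) (s : Vertex → ℕ → ℝ) (t : ℝ) :
    Vertex → G
  | [] => 1
  | i :: v => position x s t v * refreshed (x (i :: v)) (s (i :: v)) t

/-- The number `∑_{n ≥ 1} ∑_{|v| = n} 1{S_v(t) = e}` of vertices of the tree other than the
root that are at the identity at time `t`. -/
def visits {G : Type*} [Group G] (N : Vertex → ℕ) (x : Vertex → ℕ → G) (s : Vertex → ℕ → ℝ)
    (t : ℝ) : ℕ∞ :=
  {v : Vertex | InTree N v ∧ 1 ≤ v.length ∧ position x s t v = 1}.encard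

/-- The randomness of a dynamical branching random walk: `N v` is the number of children of `v`,
with law `μ`; `X v j` are the samples, with law `q`; and `ψ v 1, ψ v 2, …` are the points of a
Poisson process of rate `1` on `(0, ∞)`, that is, their gaps, starting from `ψ v 0 = 0`, are
i.i.d. exponential of rate `1`. All the offspring numbers, samples and gaps are independent. -/
structure IsDynamicalBRW {Ω G : Type*} [MeasurableSpace Ω] [MeasurableSpace G]
    (P : Measure Ω) (q : PMF G) (μ : PMF ℕ)
    (N : Vertex → Ω → ℕ) (X : Vertex → ℕ → Ω → G) (ψ : Vertex → ℕ → Ω → ℝ) : Prop where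
  measurable_offspring : ∀ v, Measurable (N v)
  measurable_sample : ∀ v j, Measurable (X v j)
  measurable_clock : ∀ v j, Measurable (ψ v j)
  law_offspring : ∀ v, P.map (N v) = μ.toMeasure
  law_sample : ∀ v j, P.map (X v j) = q.toMeasure
  clock_zero : ∀ v ω, ψ v 0 ω = 0
  law_gap : ∀ v j, P.map (fun ω => ψ v (j + 1) ω - ψ v j ω) = expMeasure 1
  indep : iIndep
    (Sum.elim (fun v : Vertex => MeasurableSpace.comap (N v) inferInstance)
      (Sum.elim (fun p : Vertex × ℕ => MeasurableSpace.comap (X p.1 p.2) inferInstance)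
        (fun p : Vertex × ℕ =>
          MeasurableSpace.comap (fun ω => ψ p.1 (p.2 + 1) ω - ψ p.1 p.2 ω) inferInstance))) P

end

end DynBRW

namespace DynBRW

/-! ### Sources of randomness -/

/-! (i) This is a first-moment bound made uniform in time. On `[0, T]` the position of a vertex `v`
with `|v| = n` changes only when one of the clocks on its geodesic rings, so a visit to the identity
at any time in `[0, T]` gives one at a ring time (time `0` included). The expected number of ring
times is at most `n + 1` times a constant depending on `T`, and a ring time depends on the clocks
alone. The samples selected at that time are therefore still i.i.d. of law `q`, and the position has
the law of the static walk (`measure_inter_selectedPosition`). Hence the expected number of vertices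
that are at the identity at some time in `[0, T]` is of order `∑ n p⁽ⁿ⁾(e,e) mⁿ`, and Borel–Cantelli
applies.

(ii) Cut time into intervals `[a, b]` so short that an edge is static, i.e. not refreshed during
`[a, b]`, with probability at least `s`, where `s < 1` is close to `1`. Being static is independent
of the label at time `a`, so the static edges carry a percolated branching random walk that does not
change during `[a, b]`. Since `m > 1/ρ`, there are `r < m`, `s` and `n ≥ 1` with `(r s)ⁿ p⁽ⁿ⁾(e,e) ≥
1` (`exists_supercritical_generation`). Taking `r` strictly below `m` absorbs the second-order terms
of the branching recursion (`exists_branching_bound`), so a small lower bound `x` for the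
probability of a visit to the identity reproduces itself after every block of `n` generations
(`le_measure_hit_add`). With probability at least `x` the static cluster of a vertex thus returns in
infinitely many generations, and by conditional Borel–Cantelli and irreducibility it then visits
every position infinitely often. A zero-one law along one ray of the tree yields almost surely a
vertex `u` with such a cluster.

The path from the root to `u` may still be refreshed during `[a, b]`. This does no harm: wherever
`u` is at time `t`, its cluster reaches the inverse displacement infinitely often. One event of full
probability thus serves all `t` in `[a, b]`, and countably many intervals cover `[0, ∞)`. -/

/-- The indices of the elementary sources of randomness: the offspring numbers, the samples and
the gaps of the clocks. -/
abbrev Source : Type := Vertex ⊕ (Vertex × ℕ) ⊕ (Vertex × ℕ)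

/-- The `σ`-algebra of one source of randomness. -/
@[reducible]
def sourceAlgebra {Ω G : Type*} [MeasurableSpace G]
    (N : Vertex → Ω → ℕ) (X : Vertex → ℕ → Ω → G) (ψ : Vertex → ℕ → Ω → ℝ) :
    Source → MeasurableSpace Ω :=
  Sum.elim (fun v : Vertex => MeasurableSpace.comap (N v) inferInstance)
    (Sum.elim (fun p : Vertex × ℕ => MeasurableSpace.comap (X p.1 p.2) inferInstance)
      (fun p : Vertex × ℕ =>
        MeasurableSpace.comap (fun ω => ψ p.1 (p.2 + 1) ω - ψ p.1 p.2 ω) inferInstance))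

/-- The `σ`-algebra generated by a set of sources. -/
@[reducible]
def info {Ω G : Type*} [MeasurableSpace G]
    (N : Vertex → Ω → ℕ) (X : Vertex → ℕ → Ω → G) (ψ : Vertex → ℕ → Ω → ℝ)
    (S : Set Source) : MeasurableSpace Ω :=
  ⨆ i ∈ S, sourceAlgebra N X ψ i

section Info

variable {Ω G : Type*} [MeasurableSpace G]
  {N : Vertex → Ω → ℕ} {X : Vertex → ℕ → Ω → G} {ψ : Vertex → ℕ → Ω → ℝ}

lemma info_mono {S T : Set Source} (hST : S ⊆ T) : info N X ψ S ≤ info N X ψ T :=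
  biSup_mono hST

lemma measurable_offspring_info {S : Set Source} {v : Vertex} (hv : Sum.inl v ∈ S) :
    Measurable[info N X ψ S] (N v) :=
  (comap_measurable (N v)).mono
    (le_iSup₂ (f := fun i (_ : i ∈ S) => sourceAlgebra N X ψ i) _ hv) le_rfl

lemma measurable_sample_info {S : Set Source} {v : Vertex} {j : ℕ}
    (hv : Sum.inr (Sum.inl (v, j)) ∈ S) : Measurable[info N X ψ S] (X v j) :=
  (comap_measurable (X v j)).mono
    (le_iSup₂ (f := fun i (_ : i ∈ S) => sourceAlgebra N X ψ i) _ hv) le_rfl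

lemma measurable_gap_info {S : Set Source} {v : Vertex} {j : ℕ}
    (hv : Sum.inr (Sum.inr (v, j)) ∈ S) :
    Measurable[info N X ψ S] (fun ω => ψ v (j + 1) ω - ψ v j ω) :=
  (comap_measurable (fun ω => ψ v (j + 1) ω - ψ v j ω)).mono
    (le_iSup₂ (f := fun i (_ : i ∈ S) => sourceAlgebra N X ψ i) _ hv) le_rfl

/-- The value of the first index at which a condition holds is measurable. -/
lemma measurable_sInf_nat {m : MeasurableSpace Ω} {p : ℕ → Ω → Prop}
    (hp : ∀ j, MeasurableSet[m] {ω | p j ω}) :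
    Measurable[m] (fun ω => sInf {j : ℕ | p j ω}) := by
  refine measurable_to_countable' fun k => ?_
  have : (fun ω => sInf {j : ℕ | p j ω}) ⁻¹' {k} =
      ({ω | p k ω} ∩ ⋂ i, ⋂ (_ : i < k), {ω | p i ω}ᶜ) ∪
        (if k = 0 then ⋂ i, {ω | p i ω}ᶜ else ∅) := by
    ext ω
    simp only [Set.mem_preimage, Set.mem_singleton_iff, Set.mem_union, Set.mem_inter_iff,
      Set.mem_ite_empty_right, Set.mem_iInter, Set.mem_compl_iff, Set.mem_ofPred_eq]
    constructor
    · rintro rfl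
      rcases Set.eq_empty_or_nonempty {j : ℕ | p j ω} with he | hne
      · right
        refine ⟨by rw [he]; exact Nat.sInf_empty, fun i hi => ?_⟩
        have : i ∈ ({j : ℕ | p j ω}) := hi
        rw [he] at this
        exact this
      · exact Or.inl ⟨Nat.sInf_mem hne, fun i hi => Nat.notMem_of_lt_sInf hi⟩
    · rintro (⟨h1, h2⟩ | ⟨rfl, h2⟩)
      · refine le_antisymm (Nat.sInf_le h1) ?_
        by_contra! hlt
        exact h2 _ hlt (Nat.sInf_mem (s := {j : ℕ | p j ω}) ⟨k, h1⟩)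
      · have : {j : ℕ | p j ω} = ∅ := by
          ext i; simpa using h2 i
        rw [this]; exact Nat.sInf_empty
  rw [this]
  refine MeasurableSet.union ((hp k).inter ?_) ?_
  · exact MeasurableSet.iInter fun i => MeasurableSet.iInter fun _ => (hp i).compl
  · split_ifs
    · exact MeasurableSet.iInter fun i => (hp i).compl
    · exact MeasurableSet.empty

variable [MeasurableSpace Ω] {P : Measure Ω} {q : PMF G} {μ : PMF ℕ}

namespace IsDynamicalBRW

lemma sourceAlgebra_le (h : IsDynamicalBRW P q μ N X ψ) (i : Source) :
    sourceAlgebra N X ψ i ≤ ‹MeasurableSpace Ω› := by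
  rcases i with v | ⟨v, j⟩ | ⟨v, j⟩
  · exact (h.measurable_offspring v).comap_le
  · exact (h.measurable_sample v j).comap_le
  · exact ((h.measurable_clock v (j + 1)).sub (h.measurable_clock v j)).comap_le

lemma info_le (h : IsDynamicalBRW P q μ N X ψ) (S : Set Source) :
    info N X ψ S ≤ ‹MeasurableSpace Ω› :=
  iSup₂_le fun i _ => h.sourceAlgebra_le i

lemma iIndep_sourceAlgebra (h : IsDynamicalBRW P q μ N X ψ) :
    iIndep (sourceAlgebra N X ψ) P := h.indep

lemma indep_info (h : IsDynamicalBRW P q μ N X ψ) {S T : Set Source} (hST : Disjoint S T) :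
    Indep (info N X ψ S) (info N X ψ T) P :=
  indep_iSup_of_disjoint h.sourceAlgebra_le h.iIndep_sourceAlgebra hST

lemma measure_inter (h : IsDynamicalBRW P q μ N X ψ) {S T : Set Source} (hST : Disjoint S T)
    {A B : Set Ω} (hA : MeasurableSet[info N X ψ S] A) (hB : MeasurableSet[info N X ψ T] B) :
    P (A ∩ B) = P A * P B :=
  (Indep_iff _ _ _).1 (h.indep_info hST) A B hA hB

lemma measurable_clock_info (h : IsDynamicalBRW P q μ N X ψ) {S : Set Source} {v : Vertex} {j : ℕ}
    (hv : ∀ i < j, Sum.inr (Sum.inr (v, i)) ∈ S) : Measurable[info N X ψ S] (ψ v j) := by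
  induction j with
  | zero =>
    have : ψ v 0 = fun _ => 0 := funext (h.clock_zero v)
    rw [this]
    exact measurable_const
  | succ j ih =>
    have : ψ v (j + 1) = fun ω => ψ v j ω + (ψ v (j + 1) ω - ψ v j ω) := by
      funext ω; ring
    rw [this]
    exact (ih fun i hi => hv i (hi.trans j.lt_succ_self)).add
      (measurable_gap_info (hv j j.lt_succ_self))

lemma measure_sample (h : IsDynamicalBRW P q μ N X ψ) [DiscreteMeasurableSpace G]
    (v : Vertex) (j : ℕ) (g : G) : P {ω | X v j ω = g} = q g := by
  have h1 := congrArg (fun m => m {g}) (h.law_sample v j)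
  simp only [Measure.map_apply (h.measurable_sample v j) (measurableSet_singleton g)] at h1
  rw [PMF.toMeasure_apply_singleton _ _ (measurableSet_singleton g)] at h1
  exact h1

lemma measure_offspring (h : IsDynamicalBRW P q μ N X ψ) (v : Vertex) (s : Set ℕ) :
    P {ω | N v ω ∈ s} = μ.toMeasure s := by
  rw [← h.law_offspring v, Measure.map_apply (h.measurable_offspring v) (MeasurableSet.of_discrete)]
  rfl

end IsDynamicalBRW

/-- Decomposition of the measure of a set along the fibres of a countable-valued function. -/
lemma tsum_measure_inter_fiber {ι : Type*} [Countable ι] [MeasurableSpace ι]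
    [MeasurableSingletonClass ι] {κ : Ω → ι} (hκ : Measurable κ) {A : Set Ω}
    (hA : MeasurableSet A) : ∑' j, P (A ∩ {ω | κ ω = j}) = P A := by
  rw [← measure_iUnion]
  · congr 1
    ext ω
    simp
  · intro i j hij
    refine Set.disjoint_left.2 fun ω h1 h2 => hij ?_
    exact h1.2.symm.trans h2.2
  · exact fun j => hA.inter (hκ (measurableSet_singleton j))

/-- A sample that is selected by means of independent information has law `q`, independently of
this information. -/
lemma IsDynamicalBRW.measure_inter_selected [DiscreteMeasurableSpace G]
    (h : IsDynamicalBRW P q μ N X ψ)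
    {T : Set Source} {v : Vertex} (hT : ∀ j, Sum.inr (Sum.inl (v, j)) ∉ T) {κ : Ω → ℕ}
    (hκ : Measurable[info N X ψ T] κ) {A : Set Ω} (hA : MeasurableSet[info N X ψ T] A) (g : G) :
    P (A ∩ {ω | X v (κ ω) ω = g}) = P A * q g := by
  have hκ' : Measurable κ := hκ.mono (h.info_le T) le_rfl
  have hA' : MeasurableSet A := h.info_le T A hA
  have hE : MeasurableSet {ω | X v (κ ω) ω = g} := by
    have : {ω | X v (κ ω) ω = g} = ⋃ j, {ω | κ ω = j} ∩ {ω | X v j ω = g} := by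
      ext ω; simp
    rw [this]
    exact MeasurableSet.iUnion fun j => (hκ' (measurableSet_singleton j)).inter
      (h.measurable_sample v j (measurableSet_singleton g))
  -- Once the selected index is fixed to `j`, the sample is a single source, which lies outside `T`.
  rw [← tsum_measure_inter_fiber hκ' (hA'.inter hE), ← tsum_measure_inter_fiber hκ' hA',
    ← ENNReal.tsum_mul_right]
  refine tsum_congr fun j => ?_
  have : A ∩ {ω | X v (κ ω) ω = g} ∩ {ω | κ ω = j} = (A ∩ {ω | κ ω = j}) ∩ {ω | X v j ω = g} := by
    ext ω
    simp only [Set.mem_inter_iff, Set.mem_ofPred_eq]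
    constructor
    · rintro ⟨⟨h1, h2⟩, rfl⟩; exact ⟨⟨h1, rfl⟩, h2⟩
    · rintro ⟨⟨h1, rfl⟩, h2⟩; exact ⟨⟨h1, h2⟩, rfl⟩
  rw [this, ← h.measure_sample v j g]
  refine h.measure_inter (S := T) (T := {Sum.inr (Sum.inl (v, j))}) ?_ ?_ ?_
  · exact Set.disjoint_singleton_right.2 (hT j)
  · exact MeasurableSet.inter hA (hκ (measurableSet_singleton j))
  · have := measurable_sample_info (N := N) (ψ := ψ) (X := X)
      (Set.mem_singleton (Sum.inr (Sum.inl (v, j)) : Source))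
    exact this (measurableSet_singleton g)

end Info

/-! ### The walk -/

section Walk

variable {G : Type*} [Group G]

lemma walkLaw_succ_eq_bind (q : PMF G) (x : G) (n : ℕ) :
    walkLaw q x (n + 1) = q.bind fun g => walkLaw q (x * g) n := by
  induction n with
  | zero =>
    simp only [walkLaw, PMF.pure_bind]
    rfl
  | succ n ih =>
    rw [walkLaw, ih, PMF.bind_bind]
    rfl

lemma stepProb_succ_right (q : PMF G) (x y : G) (n : ℕ) :
    stepProb q (n + 1) x y = ∑' z, stepProb q n x z * q (z⁻¹ * y) := by
  classical
  simp only [stepProb, walkLaw, PMF.bind_apply, PMF.map_apply]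
  refine tsum_congr fun z => ?_
  congr 1
  rw [tsum_eq_single (z⁻¹ * y)]
  · simp
  · intro g hg
    rw [if_neg]
    rintro rfl
    simp at hg

/-- Decomposition at the first step, as needed when a tree is split at the children of its root;
decomposition at the last step serves when a geodesic is extended by one edge. -/
lemma stepProb_succ_left (q : PMF G) (x y : G) (n : ℕ) :
    stepProb q (n + 1) x y = ∑' g, q g * stepProb q n (x * g) y := by
  simp only [stepProb, walkLaw_succ_eq_bind, PMF.bind_apply]

lemma stepProb_le_one (q : PMF G) (n : ℕ) (x y : G) : stepProb q n x y ≤ 1 :=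
  PMF.coe_le_one _ _

lemma stepProb_zero (q : PMF G) (x y : G) [Decidable (x = y)] :
    stepProb q 0 x y = if x = y then 1 else 0 := by
  classical
  simp [stepProb, walkLaw, PMF.pure_apply, eq_comm]

lemma stepProb_zero_self (q : PMF G) (x : G) : stepProb q 0 x x = 1 := by
  classical
  simp [stepProb_zero]

/-- Countability makes multiplication measurable on `G × G` and allows events to be split according
to the position. -/
lemma countable_of_closure_eq_top {S : Finset G} (hS : Subgroup.closure (S : Set G) = ⊤) :
    Countable G := by
  have hsurj : Function.Surjective (FreeGroup.lift (Subtype.val : {x // x ∈ S} → G)) := by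
    rw [FreeGroup.lift_surjective_iff_closure_range_eq_top, Subtype.range_coe_subtype]
    exact hS
  exact hsurj.countable

end Walk

/-! ### The clocks -/

lemma expMeasure_one_Iic_zero : expMeasure 1 (Set.Iic 0) = 0 := by
  change (volume.withDensity (exponentialPDF 1)) (Set.Iic 0) = 0
  rw [withDensity_apply _ measurableSet_Iic]
  exact (setLIntegral_congr Iio_ae_eq_Iic).symm.trans (lintegral_exponentialPDF_of_nonpos le_rfl)

lemma expMeasure_one_Icc_le (a b : ℝ) : expMeasure 1 (Set.Icc a b) ≤ ENNReal.ofReal (b - a) := by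
  change (volume.withDensity (exponentialPDF 1)) (Set.Icc a b) ≤ _
  rw [withDensity_apply _ measurableSet_Icc]
  calc ∫⁻ x in Set.Icc a b, exponentialPDF 1 x ≤ ∫⁻ _ in Set.Icc a b, 1 := by
        refine lintegral_mono fun x => ?_
        rw [exponentialPDF_eq]
        refine ENNReal.ofReal_le_one.2 ?_
        split_ifs with hx
        · simpa using hx
        · exact zero_le_one
    _ = ENNReal.ofReal (b - a) := by simp

/-- The Laplace transform at `1` of the law of the gaps of the clocks. -/
noncomputable def gapLaplace : ℝ≥0∞ := ∫⁻ x, ENNReal.ofReal (Real.exp (-x)) ∂expMeasure 1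

lemma gapLaplace_lt_one : gapLaplace < 1 := by
  have := isProbabilityMeasure_expMeasure (r := 1) one_pos
  have hlt : ∀ᵐ x ∂expMeasure 1, ENNReal.ofReal (Real.exp (-x)) < 1 := by
    have h0 : ∀ᵐ x ∂expMeasure 1, x ∉ Set.Iic (0 : ℝ) :=
      measure_eq_zero_iff_ae_notMem.1 expMeasure_one_Iic_zero
    filter_upwards [h0] with x hx
    rw [ENNReal.ofReal_lt_one, Real.exp_lt_one_iff]
    simpa using hx
  have hle : ∫⁻ x, ENNReal.ofReal (Real.exp (-x)) ∂expMeasure 1 ≤ ∫⁻ _, 1 ∂expMeasure 1 :=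
    lintegral_mono_ae (hlt.mono fun _ => le_of_lt)
  have h1 : ∫⁻ _ : ℝ, 1 ∂expMeasure 1 = 1 := by simp
  have := lintegral_strict_mono (IsProbabilityMeasure.ne_zero (expMeasure 1)) aemeasurable_const
    (ne_top_of_le_ne_top (by simp) hle) hlt
  rwa [h1] at this

/-- A bound for the expected number of points of a clock up to time `T`. -/
noncomputable def clockBound (T : ℝ) : ℝ≥0∞ := ENNReal.ofReal (Real.exp T) * (1 - gapLaplace)⁻¹

lemma clockBound_ne_top (T : ℝ) : clockBound T ≠ ∞ :=
  ENNReal.mul_ne_top ENNReal.ofReal_ne_top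
    (ENNReal.inv_ne_top.2 (tsub_pos_of_lt gapLaplace_lt_one).ne')

lemma clockBound_mono {S T : ℝ} (hST : S ≤ T) : clockBound S ≤ clockBound T := by
  unfold clockBound
  gcongr

namespace IsDynamicalBRW

variable {Ω G : Type*} [MeasurableSpace G] [MeasurableSpace Ω] {P : Measure Ω}
  {q : PMF G} {μ : PMF ℕ}
  {N : Vertex → Ω → ℕ} {X : Vertex → ℕ → Ω → G} {ψ : Vertex → ℕ → Ω → ℝ}

lemma indepFun_clock_gap (h : IsDynamicalBRW P q μ N X ψ) (v : Vertex) (j : ℕ) :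
    IndepFun (ψ v j) (fun ω => ψ v (j + 1) ω - ψ v j ω) P := by
  rw [IndepFun_iff_Indep]
  have h1 := h.measurable_clock_info (S := {i | ∃ k < j, i = Sum.inr (Sum.inr (v, k))}) (v := v)
    (j := j) fun i hi => ⟨i, hi, rfl⟩
  have h2 := measurable_gap_info (N := N) (X := X) (ψ := ψ)
    (Set.mem_singleton (Sum.inr (Sum.inr (v, j)) : Source))
  refine indep_of_indep_of_le_left (indep_of_indep_of_le_right (h.indep_info ?_)
    h2.comap_le) h1.comap_le
  refine Set.disjoint_singleton_right.2 ?_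
  rintro ⟨k, hk, hkj⟩
  simp only [Sum.inr.injEq, Prod.mk.injEq, true_and] at hkj
  omega

lemma measurable_gap (h : IsDynamicalBRW P q μ N X ψ) (v : Vertex) (j : ℕ) :
    Measurable (fun ω => ψ v (j + 1) ω - ψ v j ω) :=
  (h.measurable_clock v (j + 1)).sub (h.measurable_clock v j)

/-- The `j`-th point is a sum of `j` independent exponential gaps, so its Laplace transform is a
power. -/
lemma lintegral_exp_neg_clock (h : IsDynamicalBRW P q μ N X ψ) [IsProbabilityMeasure P]
    (v : Vertex) (j : ℕ) :
    ∫⁻ ω, ENNReal.ofReal (Real.exp (-ψ v j ω)) ∂P = gapLaplace ^ j := by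
  induction j with
  | zero => simp [h.clock_zero]
  | succ j ih =>
    have hf : Measurable fun x : ℝ => ENNReal.ofReal (Real.exp (-x)) := by fun_prop
    have hsplit : ∀ ω, ENNReal.ofReal (Real.exp (-ψ v (j + 1) ω)) =
        ENNReal.ofReal (Real.exp (-ψ v j ω)) *
          ENNReal.ofReal (Real.exp (-(ψ v (j + 1) ω - ψ v j ω))) := by
      intro ω
      rw [← ENNReal.ofReal_mul (Real.exp_pos _).le, ← Real.exp_add]
      congr 2; ring
    simp_rw [hsplit]
    have := lintegral_mul_eq_lintegral_mul_lintegral_of_indepFun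
      (hf.comp (h.measurable_clock v j)) (hf.comp (h.measurable_gap v j))
      ((h.indepFun_clock_gap v j).comp hf hf)
    simp only [Pi.mul_apply, Function.comp_apply] at this
    rw [this, ih, pow_succ]
    congr 1
    rw [gapLaplace, ← h.law_gap v j, lintegral_map hf (h.measurable_gap v j)]

/-- Markov's inequality for `exp (-ψ)`. The bound is geometric in `j`, which makes the expected
number of points up to `T` finite without computing the Poisson law. -/
lemma measure_clock_le (h : IsDynamicalBRW P q μ N X ψ) [IsProbabilityMeasure P]
    (v : Vertex) (j : ℕ) (T : ℝ) :
    P {ω | ψ v j ω ≤ T} ≤ ENNReal.ofReal (Real.exp T) * gapLaplace ^ j := by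
  have hf : Measurable fun ω => ENNReal.ofReal (Real.exp (-ψ v j ω)) := by
    have := h.measurable_clock v j
    fun_prop
  have h1 := mul_meas_ge_le_lintegral (μ := P) hf (ENNReal.ofReal (Real.exp (-T)))
  rw [h.lintegral_exp_neg_clock] at h1
  have h2 : {ω | ψ v j ω ≤ T} ⊆
      {ω | ENNReal.ofReal (Real.exp (-T)) ≤ ENNReal.ofReal (Real.exp (-ψ v j ω))} := by
    intro ω hω
    refine ENNReal.ofReal_le_ofReal (Real.exp_le_exp.2 (neg_le_neg hω))
  have h3 : ENNReal.ofReal (Real.exp T) * ENNReal.ofReal (Real.exp (-T)) = 1 := by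
    rw [← ENNReal.ofReal_mul (Real.exp_pos _).le, ← Real.exp_add]
    simp
  calc P {ω | ψ v j ω ≤ T} ≤ P {ω | ENNReal.ofReal (Real.exp (-T)) ≤
          ENNReal.ofReal (Real.exp (-ψ v j ω))} := measure_mono h2
    _ = ENNReal.ofReal (Real.exp T) * (ENNReal.ofReal (Real.exp (-T)) *
        P {ω | ENNReal.ofReal (Real.exp (-T)) ≤ ENNReal.ofReal (Real.exp (-ψ v j ω))}) := by
          rw [← mul_assoc, h3, one_mul]
    _ ≤ _ := by gcongr

lemma tsum_measure_clock_le (h : IsDynamicalBRW P q μ N X ψ) [IsProbabilityMeasure P]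
    (v : Vertex) (T : ℝ) : ∑' j, P {ω | ψ v j ω ≤ T} ≤ clockBound T := by
  refine (ENNReal.tsum_le_tsum fun j => h.measure_clock_le v j T).trans ?_
  rw [ENNReal.tsum_mul_left, ENNReal.tsum_geometric]
  rfl

/-- Almost surely, every clock has only finitely many points in bounded time. -/
lemma ae_finite_clock_le (h : IsDynamicalBRW P q μ N X ψ) [IsProbabilityMeasure P] (T : ℝ) :
    ∀ᵐ ω ∂P, ∀ v, {j | ψ v j ω ≤ T}.Finite := by
  rw [ae_all_iff]
  intro v
  have := measure_limsup_cofinite_eq_zero (μ := P) (s := fun j => {ω | ψ v j ω ≤ T})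
    (ne_top_of_le_ne_top (clockBound_ne_top T) (h.tsum_measure_clock_le v T))
  filter_upwards [measure_eq_zero_iff_ae_notMem.1 this] with ω hω
  rw [Filter.mem_limsup_iff_frequently_mem, Filter.not_frequently] at hω
  simpa [Filter.eventually_cofinite] using hω

/-- Given the `j`-th point, the next gap must fall in an interval of length `b - a`, and the
exponential density is at most `1`. Gaps are almost surely positive, which forces the `j`-th point
to be at most `b`; keeping this factor makes the bound summable in `j`. -/
lemma measure_clock_succ_mem_Icc_le (h : IsDynamicalBRW P q μ N X ψ) [IsProbabilityMeasure P]
    (v : Vertex) (j : ℕ) (a b : ℝ) :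
    P {ω | ψ v (j + 1) ω ∈ Set.Icc a b} ≤ P {ω | ψ v j ω ≤ b} * ENNReal.ofReal (b - a) := by
  have hm := h.measurable_clock v j
  have hg := h.measurable_gap v j
  have hprod := (indepFun_iff_map_prod_eq_prod_map_map hm.aemeasurable hg.aemeasurable).1
    (h.indepFun_clock_gap v j)
  have hpos : ∀ᵐ ω ∂P, 0 < ψ v (j + 1) ω - ψ v j ω := by
    have h0 : P.map (fun ω => ψ v (j + 1) ω - ψ v j ω) (Set.Iic 0) = 0 := by
      rw [h.law_gap, expMeasure_one_Iic_zero]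
    rw [Measure.map_apply hg measurableSet_Iic] at h0
    filter_upwards [measure_eq_zero_iff_ae_notMem.1 h0] with ω hω
    simpa using hω
  set D : Set (ℝ × ℝ) := {p | p.1 ≤ b ∧ a ≤ p.1 + p.2 ∧ p.1 + p.2 ≤ b} with hD
  have hDm : MeasurableSet D := by
    have hadd := measurable_fst.add (measurable_snd (α := ℝ) (β := ℝ))
    exact (measurableSet_le measurable_fst measurable_const).inter
      ((measurableSet_le measurable_const hadd).inter (measurableSet_le hadd measurable_const))
  calc P {ω | ψ v (j + 1) ω ∈ Set.Icc a b}
      ≤ P ((fun ω => (ψ v j ω, ψ v (j + 1) ω - ψ v j ω)) ⁻¹' D) := by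
        refine measure_mono_ae ?_
        filter_upwards [hpos] with ω hω hmem
        obtain ⟨h1, h2⟩ := hmem
        refine ⟨?_, ?_, ?_⟩
        · change ψ v j ω ≤ b; linarith
        · change a ≤ ψ v j ω + (ψ v (j + 1) ω - ψ v j ω); linarith
        · change ψ v j ω + (ψ v (j + 1) ω - ψ v j ω) ≤ b; linarith
    _ = ((P.map (ψ v j)).prod (expMeasure 1)) D := by
        rw [← Measure.map_apply (hm.prodMk hg) hDm, hprod, h.law_gap]
    _ = ∫⁻ y, expMeasure 1 (Prod.mk y ⁻¹' D) ∂(P.map (ψ v j)) := by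
        have := isProbabilityMeasure_expMeasure (r := 1) one_pos
        exact Measure.prod_apply hDm
    _ ≤ ∫⁻ y, (Set.Iic b).indicator (fun _ => ENNReal.ofReal (b - a)) y ∂(P.map (ψ v j)) := by
        refine lintegral_mono fun y => ?_
        by_cases hy : y ≤ b
        · rw [Set.indicator_of_mem (show y ∈ Set.Iic b from hy)]
          refine (measure_mono ?_).trans ((expMeasure_one_Icc_le (a - y) (b - y)).trans_eq ?_)
          · rintro z ⟨-, h1, h2⟩
            constructor <;> simp only at h1 h2 <;> linarith
          · congr 1; ring
        · rw [Set.indicator_of_notMem (show y ∉ Set.Iic b from hy)]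
          have : Prod.mk y ⁻¹' D = ∅ := by
            ext z; simp [hD, hy]
          rw [this, measure_empty]
    _ = P {ω | ψ v j ω ≤ b} * ENNReal.ofReal (b - a) := by
        rw [lintegral_indicator_const measurableSet_Iic, Measure.map_apply hm measurableSet_Iic,
          mul_comm]
        rfl

/-- The probability that a clock has a point in a given interval is at most proportional to the
length of the interval. -/
lemma measure_exists_clock_mem_Icc_le (h : IsDynamicalBRW P q μ N X ψ) [IsProbabilityMeasure P]
    (v : Vertex) (a b : ℝ) :
    P {ω | ∃ j, ψ v (j + 1) ω ∈ Set.Icc a b} ≤ clockBound b * ENNReal.ofReal (b - a) := by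
  have : {ω | ∃ j, ψ v (j + 1) ω ∈ Set.Icc a b} = ⋃ j, {ω | ψ v (j + 1) ω ∈ Set.Icc a b} := by
    ext ω; simp
  rw [this]
  refine (measure_iUnion_le _).trans ?_
  refine (ENNReal.tsum_le_tsum fun j => h.measure_clock_succ_mem_Icc_le v j a b).trans ?_
  rw [ENNReal.tsum_mul_right]
  gcongr
  exact h.tsum_measure_clock_le v b

end IsDynamicalBRW

/-! ### Positions along selected samples -/

/-- The product along the geodesic to a vertex of the samples with prescribed numbers. -/
def selectedPosition {G : Type*} [Group G] (x : Vertex → ℕ → G) (κ : Vertex → ℕ) : Vertex → G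
  | [] => 1
  | i :: v => selectedPosition x κ v * x (i :: v) (κ (i :: v))

lemma position_eq_selectedPosition {G : Type*} [Group G] (x : Vertex → ℕ → G)
    (s : Vertex → ℕ → ℝ) (t : ℝ) (v : Vertex) :
    position x s t v = selectedPosition x (fun w => sInf {j : ℕ | t < s w j}) v := by
  induction v with
  | nil => rfl
  | cons i v ih => rw [position, selectedPosition, ih]; rfl

lemma position_congr {G : Type*} [Group G] (x : Vertex → ℕ → G) (s : Vertex → ℕ → ℝ) {t t' : ℝ}
    {v : Vertex} (h : ∀ w ∈ v.tails, ∀ j, t < s w j ↔ t' < s w j) :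
    position x s t v = position x s t' v := by
  induction v with
  | nil => rfl
  | cons i v ih =>
    rw [position, position, ih fun w hw => h w (by simp_all), refreshed, refreshed]
    simp_rw [h (i :: v) (by simp)]

/-- A vertex that is at the identity at some time in `[0, T]` is there at some time in `[0, T]` at
which a clock on its geodesic rings. -/
lemma exists_clock_of_position {G : Type*} [Group G] (x : Vertex → ℕ → G) (s : Vertex → ℕ → ℝ)
    {t T : ℝ} (h0 : 0 ≤ t) (hT : t ≤ T) (hs0 : ∀ v, s v 0 = 0) (hs : ∀ v, {j | s v j ≤ T}.Finite)
    (v : Vertex) (g : G) (hv : position x s t v = g) :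
    ∃ w ∈ v.tails, ∃ j, s w j ≤ T ∧ position x s (s w j) v = g := by
  set I : Set (Vertex × ℕ) := {p | p.1 ∈ v.tails ∧ s p.1 p.2 ≤ t} with hI
  have hfin : I.Finite := by
    have : I ⊆ ⋃ w ∈ {w | w ∈ v.tails}, (fun j => (w, j)) '' {j | s w j ≤ T} := by
      rintro ⟨w, j⟩ ⟨h1, h2⟩
      simp only [Set.mem_iUnion]
      exact ⟨w, h1, j, le_trans h2 hT, rfl⟩
    exact ((List.finite_toSet _).biUnion fun w _ => (hs w).image _).subset this
  -- Every clock, even the one formally attached to the root, has its point number `0` at time `0`,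
  -- so time `0` counts as a ring.
  have hne : I.Nonempty := ⟨([], 0), by simp, by simpa [hs0] using h0⟩
  -- The latest ring up to time `t`: no clock on the geodesic rings between it and `t`, and labels
  -- are right-continuous in time.
  obtain ⟨⟨w, j⟩, ⟨hw, hj⟩, hmax⟩ := Set.exists_max_image I (fun p => s p.1 p.2) hfin hne
  refine ⟨w, hw, j, le_trans hj hT, ?_⟩
  rw [← hv]
  refine position_congr x s fun u hu k => ⟨fun h => ?_, fun h => lt_of_le_of_lt hj h⟩
  by_contra! hk
  exact absurd (hmax (u, k) ⟨hu, hk⟩) (not_le.2 h)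

/-! ### Laws of positions and generations -/

section

variable {Ω G : Type*} [MeasurableSpace G]
  {N : Vertex → Ω → ℕ} {X : Vertex → ℕ → Ω → G} {ψ : Vertex → ℕ → Ω → ℝ}

lemma measurable_selected {m : MeasurableSpace Ω} {x : ℕ → Ω → G} {κ : Ω → ℕ}
    (hx : ∀ j, Measurable[m] (x j)) (hκ : Measurable[m] κ) :
    Measurable[m] (fun ω => x (κ ω) ω) := by
  intro s hs
  have : (fun ω => x (κ ω) ω) ⁻¹' s = ⋃ j, κ ⁻¹' {j} ∩ x j ⁻¹' s := by
    ext ω; simp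
  rw [this]
  exact MeasurableSet.iUnion fun j => (hκ (measurableSet_singleton j)).inter (hx j hs)

lemma measurable_selectedPosition [Group G] [Countable G] [DiscreteMeasurableSpace G]
    {m : MeasurableSpace Ω} {x : Vertex → ℕ → Ω → G} {κ : Vertex → Ω → ℕ} {v : Vertex}
    (hx : ∀ w, w.length ≤ v.length → ∀ j, Measurable[m] (x w j)) (hκ : ∀ w, Measurable[m] (κ w)) :
    Measurable[m] (fun ω => selectedPosition (fun w j => x w j ω) (fun w => κ w ω) v) := by
  induction v with
  | nil => exact measurable_const
  | cons i v ih =>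
    have h1 := ih fun w hw => hx w (hw.trans (by simp))
    have h2 := measurable_selected (hx (i :: v) le_rfl) (hκ (i :: v))
    exact (Measurable.of_discrete (f := fun p : G × G => p.1 * p.2)).comp (h1.prodMk h2)

/-- The sources used by all the clocks. -/
def clockSources : Set Source := {i | ∃ p, i = Sum.inr (Sum.inr p)}

/-- The sources used by all the clocks, and by the samples at the vertices up to distance `n`. -/
def edgeSources (n : ℕ) : Set Source :=
  clockSources ∪ {i | ∃ p : Vertex × ℕ, p.1.length ≤ n ∧ i = Sum.inr (Sum.inl p)}

/-- The sources used by the offspring numbers at the vertices at distance less than `n`. -/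
def offspringSources (n : ℕ) : Set Source := {i | ∃ v : Vertex, v.length < n ∧ i = Sum.inl v}

lemma disjoint_offspringSources_edgeSources (m n : ℕ) :
    Disjoint (offspringSources m) (edgeSources n) := by
  rw [Set.disjoint_left]
  rintro i ⟨v, -, rfl⟩ (⟨p, hp⟩ | ⟨p, -, hp⟩) <;> cases hp

lemma measurable_selectedPosition_info [Group G] [Countable G] [DiscreteMeasurableSpace G]
    {κ : Vertex → Ω → ℕ} (hκ : ∀ w, Measurable[info N X ψ clockSources] (κ w)) (v : Vertex) :
    Measurable[info N X ψ (edgeSources v.length)]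
      (fun ω => selectedPosition (fun w j => X w j ω) (fun w => κ w ω) v) :=
  measurable_selectedPosition
    (fun w hw j => measurable_sample_info (Or.inr ⟨(w, j), hw, rfl⟩))
    (fun w => (hκ w).mono (info_mono Set.subset_union_left) le_rfl)

lemma measurableSet_inTree (v : Vertex) :
    MeasurableSet[info N X ψ (offspringSources v.length)] {ω | InTree (fun w => N w ω) v} := by
  induction v with
  | nil => simp [InTree]
  | cons i v ih =>
    have h1 : MeasurableSet[info N X ψ (offspringSources (i :: v).length)]
        {ω | InTree (fun w => N w ω) v} := by
      refine info_mono ?_ _ ih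
      rintro _ ⟨w, hw, rfl⟩
      exact ⟨w, hw.trans (by simp), rfl⟩
    have h2 : Measurable[info N X ψ (offspringSources (i :: v).length)] (N v) :=
      measurable_offspring_info ⟨v, by simp, rfl⟩
    exact MeasurableSet.inter h1 (h2 (measurableSet_Ioi (a := i)))

variable [MeasurableSpace Ω] {P : Measure Ω} {q : PMF G} {μ : PMF ℕ}

namespace IsDynamicalBRW

lemma measurable_clock_clockSources (h : IsDynamicalBRW P q μ N X ψ) (w : Vertex) (j : ℕ) :
    Measurable[info N X ψ clockSources] (ψ w j) :=
  h.measurable_clock_info fun i _ => ⟨(w, i), rfl⟩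

/-- At a random time that depends on the clocks only, the position of a vertex at distance `n`
has the law of the walk after `n` steps, independently of the clocks. -/
lemma measure_inter_selectedPosition [Group G] [Countable G] [DiscreteMeasurableSpace G]
    (h : IsDynamicalBRW P q μ N X ψ) {κ : Vertex → Ω → ℕ}
    (hκ : ∀ w, Measurable[info N X ψ clockSources] (κ w)) {A : Set Ω}
    (hA : MeasurableSet[info N X ψ clockSources] A) (v : Vertex) (g : G) :
    P (A ∩ {ω | selectedPosition (fun w j => X w j ω) (fun w => κ w ω) v = g}) =
      P A * stepProb q v.length 1 g := by
  classical
  have hA' := fun n => info_mono (N := N) (X := X) (ψ := ψ)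
    (Set.subset_union_left : clockSources ⊆ edgeSources n) A hA
  induction v generalizing g with
  | nil =>
    by_cases hg : (1 : G) = g
    · simp [selectedPosition, hg, stepProb_zero]
    · simp [selectedPosition, hg, stepProb_zero]
  | cons i v ih =>
    have hpos := measurable_selectedPosition_info hκ v
    have hpos' := measurable_selectedPosition_info hκ (i :: v)
    have hm := (h.info_le _ A (hA' 0)).inter
      ((hpos'.mono (h.info_le _) le_rfl) (measurableSet_singleton g))
    -- Split by the position `z` of the predecessor; the last label must then be `z⁻¹ * g`, and its
    -- samples are unused so far.
    refine (tsum_measure_inter_fiber (hpos.mono (h.info_le _) le_rfl) hm).symm.trans ?_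
    rw [List.length_cons, stepProb_succ_right, ← ENNReal.tsum_mul_left]
    refine tsum_congr fun z => ?_
    rw [← mul_assoc, ← ih z, ← h.measure_inter_selected (T := edgeSources v.length)
      (v := i :: v) (κ := κ (i :: v)) ?_ ?_ ?_ (z⁻¹ * g)]
    · congr 1
      ext ω
      simp only [selectedPosition, Set.mem_inter_iff, Set.mem_preimage, Set.mem_singleton_iff,
        Set.mem_ofPred_eq, eq_inv_mul_iff_mul_eq]
      constructor
      · rintro ⟨⟨h1, h2⟩, rfl⟩; exact ⟨⟨h1, rfl⟩, h2⟩
      · rintro ⟨⟨h1, rfl⟩, h2⟩; exact ⟨⟨h1, h2⟩, rfl⟩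
    · rintro j (⟨p, hp⟩ | ⟨p, hlen, hp⟩)
      · cases hp
      · obtain rfl : (i :: v, j) = p := by simpa using hp
        simp at hlen
    · exact (hκ _).mono (info_mono Set.subset_union_left) le_rfl
    · exact MeasurableSet.inter (hA' _) (hpos (measurableSet_singleton z))

/-! ### The first moment method -/

lemma tsum_measure_lt_offspring (h : IsDynamicalBRW P q μ N X ψ) (v : Vertex) :
    ∑' i, P {ω | i < N v ω} = offspringMean μ := by
  have h1 : ∀ i, P {ω | i < N v ω} = ∑' k, if i < k then μ k else 0 := by
    intro i
    refine (h.measure_offspring v (Set.Ioi i)).trans ?_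
    rw [PMF.toMeasure_apply _ MeasurableSet.of_discrete]
    refine tsum_congr fun k => ?_
    simp [Set.indicator_apply]
  simp_rw [h1]
  rw [ENNReal.tsum_comm]
  refine tsum_congr fun k => ?_
  rw [tsum_eq_sum (s := Finset.range k) (by intro i hi; rw [if_neg (by simpa using hi)])]
  rw [Finset.sum_congr rfl (g := fun _ => μ k) (by intro i hi; rw [if_pos (by simpa using hi)])]
  simp

lemma measure_inTree_cons (h : IsDynamicalBRW P q μ N X ψ) (i : ℕ) (v : Vertex) :
    P {ω | InTree (fun w => N w ω) (i :: v)} =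
      P {ω | InTree (fun w => N w ω) v} * P {ω | i < N v ω} := by
  refine h.measure_inter (S := offspringSources v.length) (T := {Sum.inl v}) ?_
    (measurableSet_inTree v) ?_
  · rw [Set.disjoint_singleton_right]
    rintro ⟨w, hw, hvw⟩
    obtain rfl : v = w := by simpa using hvw
    exact lt_irrefl _ hw
  · have : Measurable[info N X ψ {Sum.inl v}] (N v) := measurable_offspring_info rfl
    exact this (measurableSet_Ioi (a := i))

/-- The expected size of a generation. -/
lemma tsum_measure_inTree (h : IsDynamicalBRW P q μ N X ψ) [IsProbabilityMeasure P] (n : ℕ) :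
    ∑' v : Vertex, (if v.length = n then P {ω | InTree (fun w => N w ω) v} else 0) =
      offspringMean μ ^ n := by
  induction n with
  | zero =>
    rw [tsum_eq_single []]
    · simp [InTree]
    · intro v hv
      rw [if_neg (by simpa using hv)]
  | succ n ih =>
    have hinj : Function.Injective fun p : ℕ × Vertex => p.1 :: p.2 := by
      rintro ⟨i, v⟩ ⟨j, w⟩ hvw
      simpa using hvw
    rw [← hinj.tsum_eq, ENNReal.tsum_prod', ENNReal.tsum_comm, pow_succ, ← ih,
      ← ENNReal.tsum_mul_right]
    · refine tsum_congr fun v => ?_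
      by_cases hv : v.length = n
      · simp only [List.length_cons, hv, if_true, h.measure_inTree_cons]
        rw [ENNReal.tsum_mul_left, h.tsum_measure_lt_offspring]
      · simp [hv]
    · intro v hv
      cases v with
      | nil => simp at hv
      | cons i v => exact ⟨(i, v), rfl⟩

/-- The many-to-one formula: weights that depend only on the generation are summed against the
expected generation sizes. -/
lemma tsum_measure_inTree_mul (h : IsDynamicalBRW P q μ N X ψ) [IsProbabilityMeasure P]
    (f : ℕ → ℝ≥0∞) :
    ∑' v : Vertex, P {ω | InTree (fun w => N w ω) v} * f v.length =
      ∑' n, offspringMean μ ^ n * f n := by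
  simp_rw [← h.tsum_measure_inTree, ← ENNReal.tsum_mul_right]
  rw [ENNReal.tsum_comm]
  refine tsum_congr fun v => ?_
  rw [tsum_eq_single v.length]
  · simp
  · intro n hn
    simp [hn.symm]

lemma measurable_index (h : IsDynamicalBRW P q μ N X ψ) {S : Set Source} {τ : Ω → ℝ}
    (hτ : Measurable[info N X ψ S] τ) {v : Vertex} (hv : ∀ j, Sum.inr (Sum.inr (v, j)) ∈ S) :
    Measurable[info N X ψ S] (fun ω => sInf {j : ℕ | τ ω < ψ v j ω}) :=
  measurable_sInf_nat fun _ =>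
    measurableSet_lt (mδ := info N X ψ S) hτ (h.measurable_clock_info fun i _ => hv i)

variable [Group G]

/-- The event that a vertex is at the identity when a clock on its geodesic rings before `T`. -/
def ringsAtOne (X : Vertex → ℕ → Ω → G) (ψ : Vertex → ℕ → Ω → ℝ) (T : ℝ) (v : Vertex) : Set Ω :=
  ⋃ w ∈ v.tails.toFinset, ⋃ j, {ω | ψ w j ω ≤ T} ∩
    {ω | position (fun u i => X u i ω) (fun u i => ψ u i ω) (ψ w j ω) v = 1}

variable [Countable G] [DiscreteMeasurableSpace G]

lemma measurableSet_ringsAtOne (h : IsDynamicalBRW P q μ N X ψ) (T : ℝ) (v : Vertex) :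
    MeasurableSet[info N X ψ (edgeSources v.length)] (ringsAtOne X ψ T v) := by
  refine Finset.measurableSet_biUnion _ fun w _ => MeasurableSet.iUnion fun j => ?_
  have hψ := h.measurable_clock_clockSources w j
  refine MeasurableSet.inter ?_ ?_
  · exact (hψ.mono (info_mono Set.subset_union_left) le_rfl) (measurableSet_Iic (a := T))
  · simp_rw [position_eq_selectedPosition]
    exact (measurable_selectedPosition_info
      (fun u => h.measurable_index hψ fun i => ⟨(u, i), rfl⟩) v) (measurableSet_singleton 1)

/-- A union bound over the `|v| + 1` clocks and over their points. Each ring time is a function of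
the clocks, so being at the identity then has the static probability, independently of the ring
being before `T`. This is the origin of the factor `n` in the summability condition. -/
lemma measure_ringsAtOne_le (h : IsDynamicalBRW P q μ N X ψ) [IsProbabilityMeasure P] (T : ℝ)
    (v : Vertex) : P (ringsAtOne X ψ T v) ≤
      ((v.length : ℝ≥0∞) + 1) * (clockBound T * stepProb q v.length 1 1) := by
  have hone : ∀ w, P (⋃ j, {ω | ψ w j ω ≤ T} ∩
      {ω | position (fun u i => X u i ω) (fun u i => ψ u i ω) (ψ w j ω) v = 1}) ≤
        clockBound T * stepProb q v.length 1 1 := by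
    intro w
    calc _ ≤ ∑' j, P {ω | ψ w j ω ≤ T} * stepProb q v.length 1 1 := by
          refine (measure_iUnion_le _).trans (ENNReal.tsum_le_tsum fun j => ?_)
          have hψ := h.measurable_clock_clockSources w j
          simp_rw [position_eq_selectedPosition]
          exact (h.measure_inter_selectedPosition
            (fun u => h.measurable_index hψ fun i => ⟨(u, i), rfl⟩)
            (hψ (measurableSet_Iic (a := T))) v 1).le
      _ ≤ _ := by
          rw [ENNReal.tsum_mul_right]
          gcongr
          exact h.tsum_measure_clock_le w T
  refine (measure_biUnion_finset_le _ _).trans ((Finset.sum_le_sum fun w _ => hone w).trans ?_)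
  rw [Finset.sum_const, nsmul_eq_mul]
  gcongr
  have := List.toFinset_card_le v.tails
  rw [List.length_tails] at this
  exact_mod_cast this

/-- If the expected number of visits weighted by the generation is finite, then almost surely the
number of visits is finite at all times. -/
theorem ae_visits_lt_top (h : IsDynamicalBRW P q μ N X ψ) [IsProbabilityMeasure P]
    (hsum : ∑' n : ℕ, (n : ℝ≥0∞) * stepProb q n 1 1 * offspringMean μ ^ n < ∞) :
    ∀ᵐ ω ∂P, ∀ t : ℝ, 0 ≤ t →
      visits (fun v => N v ω) (fun v j => X v j ω) (fun v j => ψ v j ω) t < ⊤ := by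
  suffices hT : ∀ T : ℕ, ∀ᵐ ω ∂P, ∀ t : ℝ, 0 ≤ t → t ≤ T →
      visits (fun v => N v ω) (fun v j => X v j ω) (fun v j => ψ v j ω) t < ⊤ by
    filter_upwards [ae_all_iff.2 hT] with ω hω t ht
    obtain ⟨T, hT⟩ := exists_nat_ge t
    exact hω T t ht hT
  intro T
  set E : Vertex → Set Ω := fun v =>
    {ω | InTree (fun w => N w ω) v ∧ 1 ≤ v.length} ∩ ringsAtOne X ψ T v with hE
  have hEle : ∀ v, P (E v) ≤ P {ω | InTree (fun w => N w ω) v} *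
      (2 * clockBound T * ((v.length : ℝ≥0∞) * stepProb q v.length 1 1)) := by
    intro v
    by_cases hv : 1 ≤ v.length
    · simp only [hE, hv, and_true]
      rw [h.measure_inter (disjoint_offspringSources_edgeSources _ _) (measurableSet_inTree v)
        (h.measurableSet_ringsAtOne T v)]
      gcongr
      refine (h.measure_ringsAtOne_le T v).trans ?_
      have : (v.length : ℝ≥0∞) + 1 ≤ 2 * v.length := by
        rw [two_mul]
        gcongr
        exact_mod_cast hv
      calc _ ≤ (2 * (v.length : ℝ≥0∞)) * (clockBound T * stepProb q v.length 1 1) := by gcongr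
        _ = _ := by ring
    · simp [hE, hv]
  have hfin : ∑' v, P (E v) ≠ ∞ := by
    refine ne_top_of_le_ne_top ?_ (ENNReal.tsum_le_tsum hEle)
    rw [h.tsum_measure_inTree_mul
      (fun n => 2 * clockBound T * ((n : ℝ≥0∞) * stepProb q n 1 1))]
    have : ∀ n : ℕ, offspringMean μ ^ n * (2 * clockBound T * ((n : ℝ≥0∞) * stepProb q n 1 1)) =
        2 * clockBound T * ((n : ℝ≥0∞) * stepProb q n 1 1 * offspringMean μ ^ n) := by
      intro n; ring
    simp_rw [this]
    rw [ENNReal.tsum_mul_left]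
    exact ENNReal.mul_ne_top (ENNReal.mul_ne_top (by simp) (clockBound_ne_top _)) hsum.ne
  have hBC := measure_limsup_cofinite_eq_zero hfin
  filter_upwards [measure_eq_zero_iff_ae_notMem.1 hBC, h.ae_finite_clock_le T] with ω hω hclock
  intro t ht0 htT
  rw [Filter.mem_limsup_iff_frequently_mem, Filter.not_frequently, Filter.eventually_cofinite] at hω
  refine Set.encard_lt_top_iff.2 (hω.subset ?_)
  rintro v ⟨h1, h2, h3⟩
  simp only [Set.mem_ofPred_eq, not_not]
  refine ⟨⟨h1, h2⟩, ?_⟩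
  obtain ⟨w, hw, j, hj, hpos⟩ := exists_clock_of_position _ _ ht0 htT
    (fun v => h.clock_zero v ω) hclock v 1 h3
  simp only [ringsAtOne, Set.mem_iUnion]
  exact ⟨w, by simpa using hw, j, hj, hpos⟩

end IsDynamicalBRW

end

/-! ### Branching estimates -/

/-- By Bernoulli, `(1 - y)^k * (1 + k y) ≤ (1 - y²)^k ≤ 1`. The probability of at least one success
is thus linear in `y` up to the factor `1 / (1 + k y)`. -/
lemma mul_le_one_sub_pow (y : ℝ) (h0 : 0 ≤ y) (h1 : y ≤ 1) (k : ℕ) :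
    k * y / (1 + k * y) ≤ 1 - (1 - y) ^ k := by
  have hpos : 0 < 1 + k * y := by positivity
  have hb : 1 + k * y ≤ (1 + y) ^ k := by
    have := one_add_mul_le_pow (a := y) (by linarith) k
    linarith
  have hprod : (1 - y) ^ k * (1 + k * y) ≤ 1 := by
    calc (1 - y) ^ k * (1 + k * y) ≤ (1 - y) ^ k * (1 + y) ^ k := by
          gcongr
      _ = (1 - y ^ 2) ^ k := by rw [← mul_pow]; ring
      _ ≤ 1 := pow_le_one₀ (by nlinarith) (by nlinarith)
  rw [div_le_iff₀ hpos]
  nlinarith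

/-- If each child succeeds independently with a small probability `y`, then the probability that
some child succeeds is at least `r * y`, for any `r` less than the mean offspring. -/
lemma exists_branching_bound (μ : PMF ℕ) {r : ℝ} (hr0 : 0 < r)
    (hr : ENNReal.ofReal r < offspringMean μ) :
    ∃ K : ℕ, ∃ ε : ℝ, 0 < ε ∧ ε ≤ 1 ∧ ∀ y, 0 ≤ y → y ≤ ε →
      r * y ≤ ∑ k ∈ Finset.range K, (μ k).toReal * (1 - (1 - y) ^ k) := by
  have htend := ENNReal.tendsto_nat_tsum (fun k : ℕ => (k : ℝ≥0∞) * μ k)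
  obtain ⟨K, hK⟩ := (htend.eventually (lt_mem_nhds hr)).exists
  have hne : ∀ k, μ k ≠ ∞ := fun k => PMF.apply_ne_top μ k
  have hK' : r < ∑ k ∈ Finset.range K, (k : ℝ) * (μ k).toReal := by
    have hsum : ∑ k ∈ Finset.range K, (k : ℝ≥0∞) * μ k =
        ENNReal.ofReal (∑ k ∈ Finset.range K, (k : ℝ) * (μ k).toReal) := by
      rw [ENNReal.ofReal_sum_of_nonneg fun k _ => by positivity]
      refine Finset.sum_congr rfl fun k _ => ?_
      rw [ENNReal.ofReal_mul (by positivity), ENNReal.ofReal_natCast,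
        ENNReal.ofReal_toReal (hne k)]
    rw [hsum] at hK
    exact lt_of_not_ge fun hle => absurd hK (not_lt.2 (ENNReal.ofReal_le_ofReal hle))
  set M := ∑ k ∈ Finset.range K, (k : ℝ) * (μ k).toReal with hM
  have hKpos : (0 : ℝ) < K + 1 := by positivity
  -- The truncated mean `M` exceeds `r`, and this `ε` ensures `r * (1 + K * y) ≤ M`. Truncation at
  -- `K` also covers an infinite mean; the `+ 1` avoids dividing by zero.
  refine ⟨K, min 1 ((M / r - 1) / (K + 1)), ?_, min_le_left _ _, fun y h0 hy => ?_⟩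
  · refine lt_min one_pos (div_pos ?_ hKpos)
    rw [sub_pos, one_lt_div hr0]
    exact hK'
  · have hy1 : y ≤ 1 := hy.trans (min_le_left _ _)
    have hy2 : (K + 1) * y ≤ M / r - 1 := by
      have := hy.trans (min_le_right _ _)
      rwa [le_div_iff₀ hKpos, mul_comm] at this
    have hden : 0 < 1 + K * y := by positivity
    have hlow : M * (y / (1 + K * y)) ≤
        ∑ k ∈ Finset.range K, (μ k).toReal * (1 - (1 - y) ^ k) := by
      rw [hM, Finset.sum_mul]
      refine Finset.sum_le_sum fun k hk => ?_
      have hkK : (k : ℝ) ≤ K := by exact_mod_cast (Finset.mem_range.1 hk).le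
      have : (k : ℝ) * (y / (1 + K * y)) ≤ 1 - (1 - y) ^ k := by
        refine le_trans ?_ (mul_le_one_sub_pow y h0 hy1 k)
        rw [mul_div_assoc]
        gcongr
      calc _ = (μ k).toReal * (k * (y / (1 + K * y))) := by ring
        _ ≤ _ := by gcongr
    refine le_trans ?_ hlow
    rw [← mul_div_assoc, le_div_iff₀ hden]
    have h3 : r * (1 + K * y) ≤ M := by
      have : 1 + K * y ≤ M / r := by linarith
      rw [le_div_iff₀ hr0] at this
      linarith
    nlinarith

/-! ### Criteria for events that happen infinitely often -/

lemma tendsto_sum_atTop_of_frequently {f : ℕ → ℝ} (h0 : ∀ n, 0 ≤ f n) {c : ℝ} (hc : 0 < c)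
    (hf : ∃ᶠ n in Filter.atTop, c ≤ f n) :
    Filter.Tendsto (fun n => ∑ k ∈ Finset.range n, f k) Filter.atTop Filter.atTop := by
  by_contra hcon
  have hs := (summable_iff_not_tendsto_nat_atTop_of_nonneg h0).2 hcon
  obtain ⟨n, hn1, hn2⟩ := (hf.and_eventually
    (hs.tendsto_atTop_zero.eventually (gt_mem_nhds hc))).exists
  exact absurd hn1 (not_le.2 hn2)

/-- Reverse Fatou for sets, by continuity from above of a finite measure; no independence is needed.
-/
lemma le_measureReal_limsup {Ω : Type*} [MeasurableSpace Ω] {P : Measure Ω} [IsFiniteMeasure P]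
    {s : ℕ → Set Ω} (hs : ∀ n, MeasurableSet (s n)) {x : ℝ} (hx : ∀ n, x ≤ P.real (s n)) :
    x ≤ P.real (Filter.limsup s Filter.atTop) := by
  rw [Filter.limsup_eq_iInf_iSup_of_nat]
  simp only [Set.iInf_eq_iInter, Set.iSup_eq_iUnion]
  have hanti : Antitone fun n => ⋃ i, ⋃ (_ : i ≥ n), s i := by
    intro m n hmn
    exact Set.iUnion_mono fun i => Set.iUnion_subset fun hi =>
      Set.subset_iUnion (fun _ : i ≥ m => s i) (le_trans hmn hi)
  have htend := tendsto_measure_iInter_atTop (μ := P)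
    (fun n => (MeasurableSet.iUnion fun i => MeasurableSet.iUnion fun _ : i ≥ n =>
      hs i).nullMeasurableSet) hanti ⟨0, measure_ne_top _ _⟩
  refine ge_of_tendsto' ((ENNReal.tendsto_toReal (measure_ne_top _ _)).comp htend) fun n => ?_
  refine (hx n).trans (measureReal_mono ?_ (measure_ne_top _ _))
  exact Set.subset_iUnion₂_of_subset n le_rfl subset_rfl

/-! ### Sources of subtrees and generations -/

section

variable {Ω G : Type*} [Group G]
  {N : Vertex → Ω → ℕ} {X : Vertex → ℕ → Ω → G} {ψ : Vertex → ℕ → Ω → ℝ}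

/-- The sources used by the edge from the predecessor of `v` to `v`. -/
def edgeAt (v : Vertex) : Set Source :=
  {i | ∃ j, i = Sum.inr (Sum.inl (v, j)) ∨ i = Sum.inr (Sum.inr (v, j))}

/-- The sources used by the part of the subtree of descendants of `u` up to `L` generations
below `u`. -/
def below (u : Vertex) (L : ℕ) : Set Source :=
  {i | ∃ w : Vertex, (i = Sum.inl (w ++ u) ∧ w.length < L) ∨
    (i ∈ edgeAt (w ++ u) ∧ w ≠ [] ∧ w.length ≤ L)}

/-- The sources used by the first `L` generations. -/
def upTo (L : ℕ) : Set Source :=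
  {i | ∃ v : Vertex, (i = Sum.inl v ∧ v.length < L) ∨ (i ∈ edgeAt v ∧ v.length ≤ L)}

lemma edgeAt_inj {v w : Vertex} {i : Source} (hv : i ∈ edgeAt v) (hw : i ∈ edgeAt w) : v = w := by
  obtain ⟨j, rfl | rfl⟩ := hv <;> obtain ⟨k, hk | hk⟩ := hw <;> simp_all

lemma inl_notMem_edgeAt (v w : Vertex) : (Sum.inl v : Source) ∉ edgeAt w := by
  rintro ⟨j, hj | hj⟩ <;> cases hj

lemma upTo_mono {m n : ℕ} (hmn : m ≤ n) : upTo m ⊆ upTo n := by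
  rintro i ⟨v, ⟨h1, h2⟩ | ⟨h1, h2⟩⟩
  · exact ⟨v, Or.inl ⟨h1, by omega⟩⟩
  · exact ⟨v, Or.inr ⟨h1, by omega⟩⟩

lemma below_subset_upTo (u : Vertex) (L : ℕ) : below u L ⊆ upTo (u.length + L) := by
  rintro i ⟨w, ⟨h1, h2⟩ | ⟨h1, -, h2⟩⟩
  · exact ⟨_, Or.inl ⟨h1, by simp; omega⟩⟩
  · exact ⟨_, Or.inr ⟨h1, by simp; omega⟩⟩

/-- The conventions are tuned to this: the offspring number of `u` belongs to the future of `u`, the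
edge leading to `u` to its past. -/
lemma disjoint_below_upTo (u : Vertex) (L : ℕ) : Disjoint (below u L) (upTo u.length) := by
  rw [Set.disjoint_left]
  rintro i ⟨w, ⟨rfl, -⟩ | ⟨h1, h2, -⟩⟩ ⟨v, ⟨h3, h4⟩ | ⟨h3, h4⟩⟩
  · obtain rfl : w ++ u = v := by simpa using h3
    simp at h4
  · exact inl_notMem_edgeAt _ _ h3
  · rw [h3] at h1
    exact inl_notMem_edgeAt _ _ h1
  · obtain rfl := edgeAt_inj h1 h3
    have := List.length_pos_iff.2 h2
    simp only [List.length_append] at h4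
    omega

/-- The sources used by the child number `i` of `u`, its edge and `L` generations below it. -/
def branch (u : Vertex) (L i : ℕ) : Set Source := edgeAt (i :: u) ∪ below (i :: u) L

lemma exists_of_mem_branch {u : Vertex} {L i : ℕ} {a : Source} (ha : a ∈ branch u L i) :
    ∃ w : Vertex, a = Sum.inl (w ++ i :: u) ∨ a ∈ edgeAt (w ++ i :: u) := by
  rcases ha with ha | ⟨w, ⟨ha, -⟩ | ⟨ha, -⟩⟩
  · exact ⟨[], Or.inr ha⟩
  · exact ⟨w, Or.inl ha⟩
  · exact ⟨w, Or.inr ha⟩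

lemma disjoint_branch (u : Vertex) (L : ℕ) {i j : ℕ} (hij : i ≠ j) :
    Disjoint (branch u L i) (branch u L j) := by
  have key : ∀ w w' : Vertex, w ++ i :: u ≠ w' ++ j :: u := by
    intro w w' hw
    have h1 : (w ++ [i]) ++ u = (w' ++ [j]) ++ u := by simpa using hw
    have h2 := List.append_cancel_right h1
    exact hij (by simpa using (List.append_inj' h2 rfl).2)
  rw [Set.disjoint_left]
  intro a ha hb
  obtain ⟨w, hw⟩ := exists_of_mem_branch ha
  obtain ⟨w', hw'⟩ := exists_of_mem_branch hb
  rcases hw with rfl | hw <;> rcases hw' with hw' | hw'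
  · exact key w w' (by simpa using hw')
  · exact inl_notMem_edgeAt _ _ hw'
  · rw [hw'] at hw
    exact inl_notMem_edgeAt _ _ hw
  · exact key w w' (edgeAt_inj hw hw')

lemma inl_notMem_branch (u : Vertex) (L i : ℕ) : (Sum.inl u : Source) ∉ branch u L i := by
  intro h
  obtain ⟨w, hw | hw⟩ := exists_of_mem_branch h
  · have := congrArg List.length (Sum.inl.inj hw)
    simp at this
    omega
  · exact inl_notMem_edgeAt _ _ hw

lemma edgeAt_disjoint_below (u : Vertex) (L : ℕ) : Disjoint (edgeAt u) (below u L) := by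
  refine ((disjoint_below_upTo u L).mono_right ?_).symm
  exact fun i hi => ⟨u, Or.inr ⟨hi, le_rfl⟩⟩

/-! ### The static cluster -/

/-- The event that the path from `u` to its descendant `w ++ u` is in the tree and has all its
edges static. -/
def linked (N : Vertex → Ω → ℕ) (B : Vertex → Set Ω) (u : Vertex) : Vertex → Set Ω
  | [] => Set.univ
  | i :: w => linked N B u w ∩ {ω | i < N (w ++ u) ω} ∩ B (i :: (w ++ u))

/-- The product of the labels along the path from `u` to its descendant `w ++ u`. -/
def increment (Y : Vertex → Ω → G) (u : Vertex) (ω : Ω) : Vertex → G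
  | [] => 1
  | i :: w => increment Y u ω w * Y (i :: (w ++ u)) ω

/-- The event that the static cluster of `u`, with `u` at the position `g`, has a vertex at the
identity `L` generations below `u`. -/
def hit (N : Vertex → Ω → ℕ) (B : Vertex → Set Ω) (Y : Vertex → Ω → G) (L : ℕ) (u : Vertex)
    (g : G) : Set Ω :=
  {ω | ∃ w : Vertex, w.length = L ∧ ω ∈ linked N B u w ∧ g * increment Y u ω w = 1}

/-- The event that the static cluster of `u` visits every position in infinitely many
generations. -/
def recurrentAt (N : Vertex → Ω → ℕ) (B : Vertex → Set Ω) (Y : Vertex → Ω → G) (u : Vertex) :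
    Set Ω :=
  {ω | ∀ g, ∃ᶠ L in Filter.atTop, ω ∈ hit N B Y L u g}

variable {B : Vertex → Set Ω} {Y : Vertex → Ω → G}

lemma linked_append (u w w' : Vertex) :
    linked N B u (w' ++ w) = linked N B u w ∩ linked N B (w ++ u) w' := by
  induction w' with
  | nil => simp [linked]
  | cons i w' ih =>
    simp only [List.cons_append, linked, ih, List.append_assoc]
    ext ω; simp only [Set.mem_inter_iff]; tauto

lemma increment_append (u w w' : Vertex) (ω : Ω) :
    increment Y u ω (w' ++ w) = increment Y u ω w * increment Y (w ++ u) ω w' := by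
  induction w' with
  | nil => simp [increment]
  | cons i w' ih => simp only [List.cons_append, increment, ih, List.append_assoc, mul_assoc]

lemma hit_zero (u : Vertex) : hit N B Y 0 u 1 = Set.univ :=
  Set.eq_univ_of_forall fun _ => ⟨[], rfl, trivial, mul_one 1⟩

/-- Concatenation of static paths: a return to the identity restarts the process from a descendant.
-/
lemma linked_inter_hit_subset (u w : Vertex) (ℓ : ℕ) (g : G) :
    linked N B u w ∩ {ω | increment Y u ω w = 1} ∩ hit N B Y ℓ (w ++ u) g ⊆
      hit N B Y (w.length + ℓ) u g := by
  rintro ω ⟨⟨h1, h2⟩, w', h3, h4, h5⟩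
  refine ⟨w' ++ w, by simp [h3, add_comm], by rw [linked_append]; exact ⟨h1, h4⟩, ?_⟩
  rw [increment_append, show increment Y u ω w = 1 from h2, one_mul]
  exact h5

lemma child_subset_hit (u : Vertex) (i L : ℕ) (g h : G) :
    {ω | i < N u ω} ∩ ((B (i :: u) ∩ {ω | Y (i :: u) ω = h}) ∩ hit N B Y L (i :: u) (g * h)) ⊆
      hit N B Y (L + 1) u g := by
  rintro ω ⟨h1, ⟨h2, h3⟩, w, h4, h5, h6⟩
  refine ⟨w ++ [i], by simp [h4], ?_, ?_⟩
  · rw [linked_append]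
    exact ⟨⟨⟨trivial, h1⟩, h2⟩, h5⟩
  · rw [increment_append, ← mul_assoc]
    have : increment Y u ω [i] = h := by simpa [increment] using h3
    rw [this]
    exact h6

/-- If the edges that are static have the prescribed labels at time `t`, and the static cluster of
a vertex of the tree visits all positions in infinitely many generations, then there are
infinitely many visits to the identity at time `t`. -/
lemma visits_eq_top {ω : Ω} {t : ℝ}
    (hY : ∀ v, ω ∈ B v → refreshed (fun j => X v j ω) (fun j => ψ v j ω) t = Y v ω)
    {u : Vertex} (hu : InTree (fun v => N v ω) u) (hrec : ω ∈ recurrentAt N B Y u) :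
    visits (fun v => N v ω) (fun v j => X v j ω) (fun v j => ψ v j ω) t = ⊤ := by
  have key : ∀ w, ω ∈ linked N B u w → InTree (fun v => N v ω) (w ++ u) ∧
      position (fun v j => X v j ω) (fun v j => ψ v j ω) t (w ++ u) =
        position (fun v j => X v j ω) (fun v j => ψ v j ω) t u * increment Y u ω w := by
    intro w
    induction w with
    | nil => exact fun _ => ⟨hu, (mul_one _).symm⟩
    | cons i w ih =>
      rintro ⟨⟨h1, h2⟩, h3⟩
      obtain ⟨h4, h5⟩ := ih h1
      refine ⟨⟨h4, h2⟩, ?_⟩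
      rw [List.cons_append, position, increment, h5, hY _ h3, mul_assoc]
  rw [visits, Set.encard_eq_top_iff]
  intro hfin
  obtain ⟨M, hM⟩ := (hfin.image List.length).bddAbove
  -- Recurrence is used at the position of `u` at time `t`, which is not controlled; this is why
  -- `recurrentAt` quantifies over all `g`.
  obtain ⟨L, hL, w, hw, h1, h2⟩ := ((hrec
    (position (fun v j => X v j ω) (fun v j => ψ v j ω) t u)).and_eventually
      (Filter.eventually_gt_atTop M)).exists.imp fun L h => h.symm
  obtain ⟨h3, h4⟩ := key w h1
  have := hM ⟨w ++ u, ⟨h3, by simp; omega, h4.trans h2⟩, rfl⟩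
  simp only [List.length_append] at this
  omega

end

/-! ### Recurrence of the static cluster -/

section

variable {Ω G : Type*} [MeasurableSpace G]
  {N : Vertex → Ω → ℕ} {X : Vertex → ℕ → Ω → G} {ψ : Vertex → ℕ → Ω → ℝ}
  {B : Vertex → Set Ω} {Y : Vertex → Ω → G}

/-- The events `B v` and the labels `Y v` depend on the edge to `v` only, and an edge is static
with label `g` with probability at least `s * q g`. -/
structure IsStaticEdges [MeasurableSpace Ω] (P : Measure Ω) (q : PMF G)
    (N : Vertex → Ω → ℕ) (X : Vertex → ℕ → Ω → G) (ψ : Vertex → ℕ → Ω → ℝ)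
    (B : Vertex → Set Ω) (Y : Vertex → Ω → G) (s : ℝ) : Prop where
  measurableSet_static : ∀ v, MeasurableSet[info N X ψ (edgeAt v)] (B v)
  measurable_label : ∀ v, Measurable[info N X ψ (edgeAt v)] (Y v)
  le_measure : ∀ v g, s * (q g).toReal ≤ P.real (B v ∩ {ω | Y v ω = g})

variable [MeasurableSpace Ω] {P : Measure Ω} {q : PMF G} {μ : PMF ℕ} {s : ℝ}

namespace IsStaticEdges

lemma edgeAt_subset_below {u w : Vertex} (hw : w ≠ []) : edgeAt (w ++ u) ⊆ below u w.length :=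
  fun _ hi => ⟨w, Or.inr ⟨hi, hw, le_rfl⟩⟩

lemma below_mono {u : Vertex} {m n : ℕ} (hmn : m ≤ n) : below u m ⊆ below u n := by
  rintro i ⟨w, ⟨h1, h2⟩ | ⟨h1, h2, h3⟩⟩
  · exact ⟨w, Or.inl ⟨h1, by omega⟩⟩
  · exact ⟨w, Or.inr ⟨h1, h2, by omega⟩⟩

lemma measurableSet_linked (hs : IsStaticEdges P q N X ψ B Y s) (u w : Vertex) :
    MeasurableSet[info N X ψ (below u w.length)] (linked N B u w) := by
  induction w with
  | nil => exact MeasurableSet.univ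
  | cons i w ih =>
    refine MeasurableSet.inter (MeasurableSet.inter ?_ ?_) ?_
    · exact info_mono (below_mono (by simp)) _ ih
    · have : Measurable[info N X ψ (below u (i :: w).length)] (N (w ++ u)) :=
        measurable_offspring_info ⟨w, Or.inl ⟨rfl, by simp⟩⟩
      exact this (measurableSet_Ioi (a := i))
    · exact info_mono (edgeAt_subset_below (w := i :: w) (by simp)) _
        (hs.measurableSet_static (i :: (w ++ u)))

variable [Group G] [Countable G] [DiscreteMeasurableSpace G]

lemma measurable_increment (hs : IsStaticEdges P q N X ψ B Y s) (u w : Vertex) :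
    Measurable[info N X ψ (below u w.length)] (fun ω => increment Y u ω w) := by
  induction w with
  | nil => exact measurable_const
  | cons i w ih =>
    have h1 : Measurable[info N X ψ (below u (i :: w).length)] (fun ω => increment Y u ω w) :=
      ih.mono (info_mono (below_mono (by simp))) le_rfl
    have h2 : Measurable[info N X ψ (below u (i :: w).length)] (Y (i :: (w ++ u))) :=
      (hs.measurable_label _).mono
        (info_mono (edgeAt_subset_below (w := i :: w) (by simp))) le_rfl
    exact (Measurable.of_discrete (f := fun p : G × G => p.1 * p.2)).comp (h1.prodMk h2)

lemma measurableSet_hit (hs : IsStaticEdges P q N X ψ B Y s) (L : ℕ) (u : Vertex) (g : G) :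
    MeasurableSet[info N X ψ (below u L)] (hit N B Y L u g) := by
  have : hit N B Y L u g = ⋃ w : {w : Vertex // w.length = L},
      linked N B u w ∩ (fun ω => increment Y u ω w) ⁻¹' {h | g * h = 1} := by
    ext ω
    simp only [hit, Set.mem_ofPred_eq, Set.mem_iUnion, Set.mem_inter_iff, Set.mem_preimage,
      Subtype.exists, exists_prop]
  rw [this]
  refine MeasurableSet.iUnion ?_
  rintro ⟨w, rfl⟩
  exact (hs.measurableSet_linked u w).inter (hs.measurable_increment u w MeasurableSet.of_discrete)

lemma measurableSet_recurrentAt (hs : IsStaticEdges P q N X ψ B Y s) (u : Vertex) :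
    MeasurableSet[info N X ψ (⋃ L, below u L)] (recurrentAt N B Y u) := by
  have : recurrentAt N B Y u =
      ⋂ g, Filter.limsup (fun L => hit N B Y L u g) Filter.atTop := by
    ext ω
    simp only [recurrentAt, Set.mem_iInter, Filter.mem_limsup_iff_frequently_mem]
    rfl
  rw [this]
  exact MeasurableSet.iInter fun g =>
    @MeasurableSet.measurableSet_limsup _ (info N X ψ (⋃ L, below u L)) _ fun L =>
      info_mono (Set.subset_iUnion _ L) _ (hs.measurableSet_hit L u g)

end IsStaticEdges

namespace IsDynamicalBRW

lemma measureReal_inter (h : IsDynamicalBRW P q μ N X ψ) {S T : Set Source} (hST : Disjoint S T)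
    {A C : Set Ω} (hA : MeasurableSet[info N X ψ S] A) (hC : MeasurableSet[info N X ψ T] C) :
    P.real (A ∩ C) = P.real A * P.real C := by
  simp only [Measure.real, h.measure_inter hST hA hC, ENNReal.toReal_mul]

variable [IsProbabilityMeasure P]

/-- By independence of disjoint sources, `k` failures, each of probability at most `1 - y`,
multiply, also with an independent event `A` such as a given number of children. -/
lemma measureReal_inter_iInter_compl_le (h : IsDynamicalBRW P q μ N X ψ) {T : Set Source}
    {S : ℕ → Set Source} (hS : ∀ i j, i ≠ j → Disjoint (S i) (S j)) (hT : ∀ i, Disjoint T (S i))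
    {A : Set Ω} (hA : MeasurableSet[info N X ψ T] A) {K : ℕ → Set Ω}
    (hK : ∀ i, MeasurableSet[info N X ψ (S i)] (K i)) {y : ℝ} (hy1 : y ≤ 1)
    (hy : ∀ i, y ≤ P.real (K i)) (k : ℕ) :
    MeasurableSet[info N X ψ (T ∪ ⋃ i ∈ Set.Iio k, S i)] (A ∩ ⋂ i ∈ Set.Iio k, (K i)ᶜ) ∧
      P.real (A ∩ ⋂ i ∈ Set.Iio k, (K i)ᶜ) ≤ P.real A * (1 - y) ^ k := by
  have hmeas : ∀ k, MeasurableSet[info N X ψ (T ∪ ⋃ i ∈ Set.Iio k, S i)]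
      (A ∩ ⋂ i ∈ Set.Iio k, (K i)ᶜ) := by
    intro k
    refine MeasurableSet.inter (info_mono Set.subset_union_left _ hA) ?_
    refine MeasurableSet.biInter (Set.to_countable _) fun i hi => MeasurableSet.compl ?_
    exact info_mono ((Set.subset_biUnion_of_mem hi).trans Set.subset_union_right) _ (hK i)
  refine ⟨hmeas k, ?_⟩
  induction k with
  | zero => simp
  | succ k ih =>
    have hsplit : A ∩ ⋂ i ∈ Set.Iio (k + 1), (K i)ᶜ =
        (A ∩ ⋂ i ∈ Set.Iio k, (K i)ᶜ) ∩ (K k)ᶜ := by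
      ext ω
      simp only [Set.mem_inter_iff, Set.mem_iInter, Set.mem_Iio, Set.mem_compl_iff,
        Nat.lt_succ_iff_lt_or_eq]
      constructor
      · rintro ⟨h1, h2⟩
        exact ⟨⟨h1, fun i hi => h2 i (Or.inl hi)⟩, h2 k (Or.inr rfl)⟩
      · rintro ⟨⟨h1, h2⟩, h3⟩
        exact ⟨h1, fun i hi => hi.elim (h2 i) fun he => he ▸ h3⟩
    have hdisj : Disjoint (T ∪ ⋃ i ∈ Set.Iio k, S i) (S k) := by
      refine Set.disjoint_union_left.2 ⟨hT k, ?_⟩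
      simp only [Set.disjoint_iUnion_left]
      exact fun i hi => hS i k (ne_of_lt hi)
    rw [hsplit, h.measureReal_inter hdisj (hmeas k) (hK k).compl,
      probReal_compl_eq_one_sub (h.info_le _ _ (hK k)), pow_succ, ← mul_assoc]
    have := hy k
    have hle := measureReal_le_one (μ := P) (s := K k)
    gcongr

variable [Group G] [Countable G] [DiscreteMeasurableSpace G]

/-- Condition on the number `k` of children. A child succeeds if its edge is static with some label
`z` and its own cluster, started at `g * z`, visits the identity; this has probability at least `y`,
and distinct children use disjoint sources. Truncation to `k < M` keeps the sum finite. -/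
lemma sum_branching_le_hit (h : IsDynamicalBRW P q μ N X ψ)
    (hs : IsStaticEdges P q N X ψ B Y s) (S : Finset G) {L : ℕ} {b : G → ℝ}
    (hb0 : ∀ g, 0 ≤ b g) (hb : ∀ u g, b g ≤ P.real (hit N B Y L u g)) (u : Vertex) (g : G)
    {y : ℝ} (hy : y = s * ∑ z ∈ S, (q z).toReal * b (g * z)) (M : ℕ) :
    ∑ k ∈ Finset.range M, (μ k).toReal * (1 - (1 - y) ^ k) ≤ P.real (hit N B Y (L + 1) u g) := by
  set K : ℕ → Set Ω := fun i => ⋃ z ∈ S,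
    (B (i :: u) ∩ {ω | Y (i :: u) ω = z}) ∩ hit N B Y L (i :: u) (g * z) with hKdef
  have hlabel : ∀ i z, MeasurableSet[info N X ψ (edgeAt (i :: u))]
      (B (i :: u) ∩ {ω | Y (i :: u) ω = z}) := fun i z =>
    MeasurableSet.inter (hs.measurableSet_static _)
      (hs.measurable_label _ (measurableSet_singleton z))
  have hKz : ∀ i z, MeasurableSet[info N X ψ (branch u L i)]
      ((B (i :: u) ∩ {ω | Y (i :: u) ω = z}) ∩ hit N B Y L (i :: u) (g * z)) := fun i z =>
    MeasurableSet.inter (info_mono Set.subset_union_left _ (hlabel i z))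
      (info_mono Set.subset_union_right _ (hs.measurableSet_hit L _ _))
  have hKm : ∀ i, MeasurableSet[info N X ψ (branch u L i)] (K i) := fun i =>
    Finset.measurableSet_biUnion _ fun z _ => hKz i z
  have hKy : ∀ i, y ≤ P.real (K i) := by
    intro i
    rw [hKdef, measureReal_biUnion_finset, hy, Finset.mul_sum]
    · refine Finset.sum_le_sum fun z _ => ?_
      rw [h.measureReal_inter (edgeAt_disjoint_below _ _) (hlabel i z)
        (hs.measurableSet_hit L _ _), ← mul_assoc]
      exact mul_le_mul (hs.le_measure _ _) (hb _ _) (hb0 _) measureReal_nonneg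
    · intro z _ z' _ hzz
      refine Set.disjoint_left.2 fun ω h1 h2 => hzz ?_
      exact h1.1.2.symm.trans h2.1.2
    · exact fun z _ => h.info_le _ _ (hKz i z)
  have hy1 : y ≤ 1 := (hKy 0).trans measureReal_le_one
  have hNm : Measurable[info N X ψ {Sum.inl u}] (N u) := measurable_offspring_info rfl
  have hone : ∀ k, (μ k).toReal * (1 - (1 - y) ^ k) ≤
      P.real ({ω | N u ω = k} ∩ ⋃ i ∈ Set.Iio k, K i) := by
    intro k
    have hA : MeasurableSet[info N X ψ {Sum.inl u}] {ω | N u ω = k} :=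
      hNm (measurableSet_singleton k)
    have hPA : P.real {ω | N u ω = k} = (μ k).toReal := by
      have := h.measure_offspring u {k}
      rw [PMF.toMeasure_apply_singleton _ _ (measurableSet_singleton k)] at this
      exact congrArg ENNReal.toReal this
    obtain ⟨-, h2⟩ := h.measureReal_inter_iInter_compl_le
      (S := branch u L) (T := {Sum.inl u}) (fun i j hij => disjoint_branch u L hij)
      (fun i => Set.disjoint_singleton_left.2 (inl_notMem_branch u L i)) hA hKm hy1 hKy k
    have hU : MeasurableSet (⋃ i ∈ Set.Iio k, K i) :=
      MeasurableSet.biUnion (Set.to_countable _) fun i _ => h.info_le _ _ (hKm i)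
    have h3 := measureReal_inter_add_sdiff (μ := P) (s := {ω | N u ω = k}) hU
    have h4 : {ω | N u ω = k} \ (⋃ i ∈ Set.Iio k, K i) =
        {ω | N u ω = k} ∩ ⋂ i ∈ Set.Iio k, (K i)ᶜ := by
      rw [Set.sdiff_eq, Set.compl_iUnion₂]
    rw [h4, hPA] at h3
    rw [hPA] at h2
    linarith
  refine (Finset.sum_le_sum fun k _ => hone k).trans ?_
  rw [← measureReal_biUnion_finset]
  · refine measureReal_mono ?_ (measure_ne_top _ _)
    intro ω hω
    simp only [Set.mem_iUnion, hKdef, Set.mem_inter_iff] at hω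
    obtain ⟨k, -, hN, i, hi, z, -, hz⟩ := hω
    have hN' : N u ω = k := hN
    exact child_subset_hit u i L g z ⟨show i < N u ω from hN' ▸ hi, hz⟩
  · intro k _ k' _ hkk
    exact Set.disjoint_left.2 fun ω h1 h2 => hkk (h1.1.symm.trans h2.1)
  · intro k _
    exact (h.info_le _ _ (hNm (measurableSet_singleton k))).inter
      (MeasurableSet.biUnion (Set.to_countable _) fun i _ => h.info_le _ _ (hKm i))

/-- Lower bounds for the probability that the static cluster visits the identity propagate from
one generation to later ones. -/
lemma le_measure_hit_add (h : IsDynamicalBRW P q μ N X ψ)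
    (hs : IsStaticEdges P q N X ψ B Y s) (hs0 : 0 ≤ s) (hs1 : s ≤ 1) {S : Finset G}
    (hqS : q.support ⊆ (S : Set G)) {r ε : ℝ} (hr : 0 < r) {K : ℕ}
    (hΦ : ∀ y, 0 ≤ y → y ≤ ε → r * y ≤ ∑ k ∈ Finset.range K, (μ k).toReal * (1 - (1 - y) ^ k))
    {x : ℝ} (hx : 0 ≤ x) {M : ℕ} (hxM : (1 + r) ^ M * x ≤ ε) {L : ℕ}
    (hbase : ∀ u, x ≤ P.real (hit N B Y L u 1)) (j : ℕ) (hj : j ≤ M) (u : Vertex) (g : G) :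
    (r * s) ^ j * (stepProb q j g 1).toReal * x ≤ P.real (hit N B Y (L + j) u g) := by
  classical
  induction j generalizing u g with
  | zero =>
    by_cases hg : g = 1
    · subst hg
      simpa [stepProb_zero_self] using hbase u
    · simp [stepProb_zero, hg]
  | succ j ih =>
    have hq : (stepProb q (j + 1) g 1).toReal =
        ∑ z ∈ S, (q z).toReal * (stepProb q j (g * z) 1).toReal := by
      rw [stepProb_succ_left, tsum_eq_sum (s := S), ENNReal.toReal_sum]
      · simp only [ENNReal.toReal_mul]
      · exact fun z _ => ENNReal.mul_ne_top (PMF.apply_ne_top _ _) (PMF.apply_ne_top _ _)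
      · intro z hz
        have : q z = 0 := by
          rw [PMF.apply_eq_zero_iff]
          exact fun hmem => hz (hqS hmem)
        rw [this, zero_mul]
    set b : G → ℝ := fun g => (r * s) ^ j * (stepProb q j g 1).toReal * x with hb
    have hsum : ∑ z ∈ S, (q z).toReal * b (g * z) =
        (r * s) ^ j * (stepProb q (j + 1) g 1).toReal * x := by
      rw [hq, Finset.mul_sum, Finset.sum_mul]
      exact Finset.sum_congr rfl fun z _ => by rw [hb]; ring
    have hp1 : (stepProb q (j + 1) g 1).toReal ≤ 1 := by
      simpa using ENNReal.toReal_mono ENNReal.one_ne_top (stepProb_le_one q (j + 1) g 1)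
    have hstep := h.sum_branching_le_hit hs S (L := L + j) (b := b)
      (fun g => by positivity) (fun u g => ih (by omega) u g) u g rfl K
    refine le_trans ?_ (le_trans (hΦ _ ?_ ?_) hstep)
    · rw [hsum]
      refine le_of_eq ?_
      ring
    · rw [hsum]
      positivity
    · rw [hsum]
      -- The argument of the branching function stays below `ε` during all `M` generations, so the
      -- linear lower bound remains available at each of them.
      have hrs : (r * s) ^ j ≤ (1 + r) ^ M := by
        calc (r * s) ^ j ≤ (1 + r) ^ j := by
              gcongr
              nlinarith
          _ ≤ (1 + r) ^ M := pow_le_pow_right₀ (by linarith) (by omega)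
      calc s * ((r * s) ^ j * (stepProb q (j + 1) g 1).toReal * x)
          ≤ 1 * ((1 + r) ^ M * 1 * x) := by gcongr
        _ ≤ ε := by linarith

end IsDynamicalBRW

end

/-! ### Zero-one law and infinitely many visits -/

section

variable {Ω G : Type*} [MeasurableSpace G]
  {N : Vertex → Ω → ℕ} {X : Vertex → ℕ → Ω → G} {ψ : Vertex → ℕ → Ω → ℝ}
  {B : Vertex → Set Ω} {Y : Vertex → Ω → G}
  [MeasurableSpace Ω] {P : Measure Ω} {q : PMF G} {μ : PMF ℕ} {s : ℝ}

/-- The generation of a source of randomness. -/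
def generation : Source → ℕ :=
  Sum.elim List.length (Sum.elim (fun p => p.1.length) (fun p => p.1.length))

lemma generation_of_mem_edgeAt {v : Vertex} {i : Source} (hi : i ∈ edgeAt v) :
    generation i = v.length := by
  obtain ⟨j, rfl | rfl⟩ := hi <;> rfl

lemma le_generation_of_mem_below {u : Vertex} {L : ℕ} {i : Source} (hi : i ∈ below u L) :
    u.length ≤ generation i := by
  obtain ⟨w, ⟨rfl, -⟩ | ⟨h, -⟩⟩ := hi
  · simp [generation]
  · simp [generation_of_mem_edgeAt h]

namespace IsDynamicalBRW

/-- A zero-one law for events that do not depend on finitely many generations. -/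
lemma measure_zero_or_one (h : IsDynamicalBRW P q μ N X ψ) [IsProbabilityMeasure P] {E : Set Ω}
    (hE : ∀ n, MeasurableSet[info N X ψ {i | n ≤ generation i}] E) : P E = 0 ∨ P E = 1 := by
  -- A single generation has infinitely many sources, so the tail is taken along generations tending
  -- to infinity rather than along the cofinite filter.
  have hbasis : (Filter.comap generation Filter.atTop).HasBasis (fun _ : ℕ => True)
      (fun n => {i | n ≤ generation i}) := Filter.atTop_basis.comap generation
  refine measure_zero_or_one_of_measurableSet_limsup (s := sourceAlgebra N X ψ)
    (f := Filter.comap generation Filter.atTop) (p := fun t => ∃ n, ∀ i ∈ t, generation i < n)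
    (ns := fun n : ℕ => {i | generation i < n}) h.sourceAlgebra_le h.iIndep_sourceAlgebra
    ?_ ?_ ?_ ?_ ?_
  · rintro t ⟨n, hn⟩
    refine hbasis.mem_iff.2 ⟨n, trivial, fun i hi hit => ?_⟩
    exact absurd (hn i hit) (not_lt.2 hi)
  · exact Monotone.directed_le fun m n hmn i hi => lt_of_lt_of_le hi hmn
  · exact fun n => ⟨n, fun i hi => hi⟩
  · exact fun i => ⟨generation i + 1, Nat.lt_succ_self _⟩
  · rw [hbasis.limsup_eq_iInf_iSup]
    simp only [MeasurableSpace.measurableSet_iInf]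
    exact fun n _ => hE n

variable [IsProbabilityMeasure P] [Group G] [Countable G] [DiscreteMeasurableSpace G]

/-- The branching property: a vertex found at the identity `L` generations below `u` has a future
independent of the past, and that future alone gives conditional probability at least `c`. The
countably many candidates for the vertex are treated separately. -/
lemma ae_le_condExp_hit (h : IsDynamicalBRW P q μ N X ψ) (hs : IsStaticEdges P q N X ψ B Y s)
    {c : ℝ} {ℓ : ℕ} {g : G} (hc : ∀ u, c ≤ P.real (hit N B Y ℓ u g)) (u : Vertex) (L : ℕ) :
    ∀ᵐ ω ∂P, ω ∈ hit N B Y L u 1 →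
      c ≤ (P[(hit N B Y (L + ℓ) u g).indicator (1 : Ω → ℝ) | info N X ψ (upTo (u.length + L))])
        ω := by
  have hint : ∀ {A : Set Ω}, MeasurableSet A → Integrable (A.indicator (1 : Ω → ℝ)) P := fun hA =>
    (integrable_const (1 : ℝ)).indicator hA
  have hw : ∀ w : {w : Vertex // w.length = L}, ∀ᵐ ω ∂P,
      ω ∈ linked N B u w ∩ {ω | increment Y u ω w = 1} →
        c ≤ (P[(hit N B Y (L + ℓ) u g).indicator (1 : Ω → ℝ) | info N X ψ (upTo (u.length + L))]) ω := by
    rintro ⟨w, rfl⟩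
    set A := linked N B u w ∩ {ω | increment Y u ω w = 1} with hA
    set R := hit N B Y ℓ (w ++ u) g with hR
    have hAm : MeasurableSet[info N X ψ (upTo (u.length + w.length))] A :=
      info_mono (below_subset_upTo u w.length) _ (MeasurableSet.inter (hs.measurableSet_linked u w)
        (hs.measurable_increment u w (measurableSet_singleton 1)))
    have hRm := hs.measurableSet_hit ℓ (w ++ u) g
    have hRm' := h.info_le _ _ hRm
    have hindep : Indep (info N X ψ (below (w ++ u) ℓ)) (info N X ψ (upTo (u.length + w.length))) P := by
      refine h.indep_info ?_
      have := disjoint_below_upTo (w ++ u) ℓ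
      rwa [List.length_append, add_comm] at this
    have h1 : P[R.indicator (1 : Ω → ℝ) | info N X ψ (upTo (u.length + w.length))] =ᵐ[P] fun _ => P.real R := by
      refine (condExp_indep_eq (h.info_le _) (h.info_le _)
        (stronglyMeasurable_one.indicator hRm) hindep).trans ?_
      rw [integral_indicator_one hRm']
    have h2 := condExp_indicator (hint hRm') hAm
    have h3 : P[A.indicator (R.indicator (1 : Ω → ℝ)) | info N X ψ (upTo (u.length + w.length))] ≤ᵐ[P]
        P[(hit N B Y (w.length + ℓ) u g).indicator (1 : Ω → ℝ) | info N X ψ (upTo (u.length + w.length))] := by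
      refine condExp_mono ((hint hRm').indicator (h.info_le _ _ hAm))
        (hint (h.info_le _ _ (hs.measurableSet_hit _ _ _))) (ae_of_all _ fun ω => ?_)
      rw [Set.indicator_indicator]
      exact Set.indicator_le_indicator_of_subset (linked_inter_hit_subset u w ℓ g)
        (fun _ => zero_le_one) ω
    filter_upwards [h1, h2, h3] with ω e1 e2 e3 hω
    rw [e2, Set.indicator_of_mem hω, e1] at e3
    exact (hc _).trans e3
  filter_upwards [ae_all_iff.2 hw] with ω hω
  rintro ⟨w, hwL, h1, h2⟩
  exact hω ⟨w, hwL⟩ ⟨h1, by simpa using h2⟩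

/-- If the static cluster visits the identity in infinitely many of the generations `L k`, then it
visits every position that can be reached with positive probability infinitely often. -/
lemma ae_frequently_hit (h : IsDynamicalBRW P q μ N X ψ) (hs : IsStaticEdges P q N X ψ B Y s)
    {c : ℝ} (hc0 : 0 < c) {ℓ : ℕ} {g : G} (hc : ∀ u, c ≤ P.real (hit N B Y ℓ u g)) (u : Vertex)
    {L : ℕ → ℕ} (hL : ∀ k, L k + ℓ ≤ L (k + 1)) :
    ∀ᵐ ω ∂P, (∃ᶠ k in Filter.atTop, ω ∈ hit N B Y (L k) u 1) →
      ∃ᶠ k in Filter.atTop, ω ∈ hit N B Y (L k + ℓ) u g := by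
  have hmono : Monotone L := monotone_nat_of_le_succ fun k => le_trans (Nat.le_add_right _ _) (hL k)
  let ℱ : Filtration ℕ ‹MeasurableSpace Ω› :=
    { seq := fun k => info N X ψ (upTo (u.length + L k))
      mono' := fun m n hmn => info_mono (upTo_mono (Nat.add_le_add_left (hmono hmn) _))
      le' := fun k => h.info_le _ }
  -- The index is shifted by one: a visit in generation `L k + ℓ` is decided by generation `L (k +
  -- 1)`, hence adapted at `k + 1`. Lévy's conditional Borel–Cantelli lemma then applies.
  let A : ℕ → Set Ω := fun k => Nat.casesOn k ∅ fun k => hit N B Y (L k + ℓ) u g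
  have hA : ∀ k, MeasurableSet[ℱ k] (A k) := by
    intro k
    cases k with
    | zero => exact @MeasurableSet.empty _ (ℱ 0)
    | succ k =>
      refine info_mono ((below_subset_upTo u (L k + ℓ)).trans (upTo_mono ?_)) _
        (hs.measurableSet_hit (L k + ℓ) u g)
      exact Nat.add_le_add_left (hL k) _
  have hnonneg : ∀ k, ∀ᵐ ω ∂P, 0 ≤ (P[(A (k + 1)).indicator (1 : Ω → ℝ) | ℱ k]) ω := fun k =>
    condExp_nonneg (ae_of_all _ fun ω => Set.indicator_nonneg (fun _ _ => zero_le_one) ω)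
  filter_upwards [ae_mem_limsup_atTop_iff P hA, ae_all_iff.2 hnonneg,
    ae_all_iff.2 fun k => h.ae_le_condExp_hit hs hc u (L k)] with ω h1 h2 h3 hω
  have hsum := h1.2 (tendsto_sum_atTop_of_frequently h2 hc0 (hω.mono fun k hk => h3 k hk))
  rw [← Filter.limsup_nat_add A 1, Filter.mem_limsup_iff_frequently_mem] at hsum
  exact hsum

/-- If the mean number of static children that are at the position of the root after some number
of generations exceeds one, then the static cluster is recurrent with positive probability. -/
lemma exists_le_measure_recurrentAt (h : IsDynamicalBRW P q μ N X ψ)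
    (hs : IsStaticEdges P q N X ψ B Y s) (hs0 : 0 < s) (hs1 : s ≤ 1) {S : Finset G}
    (hqS : q.support ⊆ (S : Set G)) (hq : IsIrreducibleWalk q) {r : ℝ} (hr0 : 0 < r)
    (hr : ENNReal.ofReal r < offspringMean μ) {n : ℕ} (hn0 : n ≠ 0)
    (hn : 1 ≤ (r * s) ^ n * (stepProb q n 1 1).toReal) :
    ∃ x : ℝ, 0 < x ∧ ∀ u, x ≤ P.real (recurrentAt N B Y u) := by
  obtain ⟨K, ε, hε0, hε1, hΦ⟩ := exists_branching_bound μ hr0 hr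
  have hpow : ∀ M : ℕ, 1 ≤ (1 + r) ^ M := fun M => one_le_pow₀ (by linarith)
  have hx : ∀ M : ℕ, (1 + r) ^ M * (ε / (1 + r) ^ M) ≤ ε := fun M =>
    (mul_div_cancel₀ ε (by positivity)).le
  have hx1 : ∀ M : ℕ, ε / (1 + r) ^ M ≤ 1 := fun M =>
    (div_le_self hε0.le (hpow M)).trans hε1
  have hbase : ∀ M u, ε / (1 + r) ^ M ≤ P.real (hit N B Y 0 u 1) := fun M u => by
    rw [hit_zero, probReal_univ]
    exact hx1 M
  -- Small enough to stay in the linear regime for `n` generations; as `(r s)ⁿ p⁽ⁿ⁾(e,e) ≥ 1`, the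
  -- bound `x` is then recovered after each block of `n` generations.
  set x := ε / (1 + r) ^ n with hxdef
  have hx0 : 0 < x := by positivity
  have hlow : ∀ k u, x ≤ P.real (hit N B Y (k * n) u 1) := by
    intro k
    induction k with
    | zero => simpa using hbase n
    | succ k ih =>
      intro u
      have := h.le_measure_hit_add hs hs0.le hs1 hqS hr0 hΦ hx0.le (hx n) ih n le_rfl u 1
      rw [Nat.succ_mul]
      refine le_trans ?_ this
      nlinarith
  refine ⟨x, hx0, fun u => ?_⟩
  -- The generations `2 ^ k * n` have gaps that eventually exceed any `ℓ`, so one subsequence works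
  -- for all targets `g`, whatever number of steps `ℓ` is needed to reach the identity from `g`.
  have hV : x ≤ P.real (Filter.limsup (fun k => hit N B Y (2 ^ k * n) u 1) Filter.atTop) :=
    le_measureReal_limsup (fun k => h.info_le _ _ (hs.measurableSet_hit _ _ _)) fun k => hlow _ u
  refine hV.trans (ENNReal.toReal_mono (measure_ne_top _ _) (measure_mono_ae ?_))
  have hall : ∀ g : G, ∀ᵐ ω ∂P,
      (∃ᶠ k in Filter.atTop, ω ∈ hit N B Y (2 ^ k * n) u 1) →
        ∃ᶠ L in Filter.atTop, ω ∈ hit N B Y L u g := by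
    intro g
    obtain ⟨ℓ, hℓ⟩ := hq g 1
    have hp : 0 < (stepProb q ℓ g 1).toReal :=
      ENNReal.toReal_pos hℓ.ne' (PMF.apply_ne_top _ _)
    have hc : ∀ u, (r * s) ^ ℓ * (stepProb q ℓ g 1).toReal * (ε / (1 + r) ^ ℓ) ≤
        P.real (hit N B Y ℓ u g) := fun u => by
      have := h.le_measure_hit_add hs hs0.le hs1 hqS hr0 hΦ (by positivity) (hx ℓ) (hbase ℓ) ℓ
        le_rfl u g
      rwa [zero_add] at this
    have hL : ∀ k, 2 ^ (k + ℓ) * n + ℓ ≤ 2 ^ (k + 1 + ℓ) * n := by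
      intro k
      have h1 : ℓ ≤ 2 ^ (k + ℓ) := (Nat.le_add_left ℓ k).trans Nat.lt_two_pow_self.le
      have h2 : 2 ^ (k + ℓ) ≤ 2 ^ (k + ℓ) * n := Nat.le_mul_of_pos_right _ (Nat.pos_of_ne_zero hn0)
      have h3 : 2 ^ (k + 1 + ℓ) * n = 2 * (2 ^ (k + ℓ) * n) := by ring
      omega
    filter_upwards [h.ae_frequently_hit hs (by positivity) hc u (L := fun k => 2 ^ (k + ℓ) * n) hL]
      with ω hω hfreq
    have h1 : ∃ᶠ k in Filter.atTop, ω ∈ hit N B Y (2 ^ (k + ℓ) * n) u 1 := by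
      rw [← Filter.map_add_atTop_eq_nat ℓ, Filter.frequently_map] at hfreq
      exact hfreq
    have hmono : StrictMono fun k : ℕ => 2 ^ (k + ℓ) * n + ℓ := by
      intro a b hab
      have : 2 ^ (a + ℓ) < 2 ^ (b + ℓ) := Nat.pow_lt_pow_right (by norm_num) (by omega)
      have := Nat.mul_lt_mul_of_pos_right this (Nat.pos_of_ne_zero hn0)
      simpa using this
    exact hmono.tendsto_atTop.frequently (hω h1)
  filter_upwards [ae_all_iff.2 hall] with ω hω hmem g
  exact hω g (Filter.mem_limsup_iff_frequently_mem.1 hmem)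

/-- Almost surely, some vertex of the tree has a recurrent static cluster. -/
lemma ae_exists_recurrentAt (h : IsDynamicalBRW P q μ N X ψ)
    (hs : IsStaticEdges P q N X ψ B Y s) (hμ0 : μ 0 = 0) {x : ℝ} (hx : 0 < x)
    (hxle : ∀ u, x ≤ P.real (recurrentAt N B Y u)) :
    ∀ᵐ ω ∂P, ∃ u, InTree (fun v => N v ω) u ∧ ω ∈ recurrentAt N B Y u := by
  -- The leftmost ray lies in the tree almost surely because `μ 0 = 0`. Recurrence at its `k`-th
  -- vertex involves only generations from `k` on, so the limsup is a tail event, of probability at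
  -- least `x` and hence `1`.
  set D : ℕ → Set Ω := fun k => recurrentAt N B Y (List.replicate k 0) with hD
  have hDm : ∀ n k, n ≤ k → MeasurableSet[info N X ψ {i | n ≤ generation i}] (D k) := by
    intro n k hnk
    refine info_mono ?_ _ (hs.measurableSet_recurrentAt _)
    refine Set.iUnion_subset fun L i hi => ?_
    have := le_generation_of_mem_below hi
    rw [List.length_replicate] at this
    exact hnk.trans this
  have hE : ∀ n, MeasurableSet[info N X ψ {i | n ≤ generation i}]
      (Filter.limsup D Filter.atTop) := by
    intro n
    rw [← Filter.limsup_nat_add D n]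
    exact @MeasurableSet.measurableSet_limsup _ (info N X ψ {i | n ≤ generation i}) _
      fun k => hDm n (k + n) (Nat.le_add_left n k)
  have hpos : x ≤ P.real (Filter.limsup D Filter.atTop) :=
    le_measureReal_limsup (fun k => h.info_le _ _ (hDm 0 k (Nat.zero_le k))) fun k => hxle _
  have hone : P (Filter.limsup D Filter.atTop) = 1 := by
    refine (h.measure_zero_or_one hE).resolve_left fun h0 => ?_
    rw [Measure.real, h0, ENNReal.toReal_zero] at hpos
    linarith
  have hN : ∀ v, ∀ᵐ ω ∂P, N v ω ≠ 0 := by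
    intro v
    have := h.measure_offspring v {0}
    rw [PMF.toMeasure_apply_singleton _ _ (measurableSet_singleton 0), hμ0] at this
    exact measure_eq_zero_iff_ae_notMem.1 this
  have hEae : ∀ᵐ ω ∂P, ω ∈ Filter.limsup D Filter.atTop :=
    (prob_compl_eq_zero_iff (h.info_le _ _ (hE 0))).2 hone
  filter_upwards [hEae, ae_all_iff.2 hN] with ω hω hNω
  obtain ⟨k, hk⟩ := (Filter.mem_limsup_iff_frequently_mem.1 hω).exists
  refine ⟨_, ?_, hk⟩
  clear hk
  induction k with
  | zero => trivial
  | succ k ih => exact ⟨ih, Nat.pos_of_ne_zero (hNω _)⟩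

end IsDynamicalBRW

end

/-! ### Edges that are not refreshed during a short time interval -/

/-- The event that the label of the edge to `v` is not refreshed in `[a, b]`. -/
def notRefreshed {Ω : Type*} (ψ : Vertex → ℕ → Ω → ℝ) (a b : ℝ) (v : Vertex) : Set Ω :=
  {ω | ∃ j, ψ v (j + 1) ω ∈ Set.Icc a b}ᶜ

lemma refreshed_eq_of_notRefreshed {G : Type*} (x : ℕ → G) {s : ℕ → ℝ} (hs0 : s 0 = 0) {a b t : ℝ}
    (ha : 0 ≤ a) (hat : a ≤ t) (htb : t ≤ b) (h : ¬ ∃ j, s (j + 1) ∈ Set.Icc a b) :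
    refreshed x s t = refreshed x s a := by
  have : {j : ℕ | t < s j} = {j : ℕ | a < s j} := by
    ext j
    refine ⟨fun hj => lt_of_le_of_lt hat hj, fun hj => ?_⟩
    cases j with
    | zero =>
      change a < s 0 at hj
      rw [hs0] at hj
      exact absurd hj (not_lt.2 ha)
    | succ j =>
      by_contra hcon
      exact h ⟨j, le_of_lt hj, (not_lt.1 hcon).trans htb⟩
  rw [refreshed, refreshed, this]

namespace IsDynamicalBRW

variable {Ω G : Type*} [MeasurableSpace G] [DiscreteMeasurableSpace G] [MeasurableSpace Ω]
  {P : Measure Ω} [IsProbabilityMeasure P] {q : PMF G} {μ : PMF ℕ}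
  {N : Vertex → Ω → ℕ} {X : Vertex → ℕ → Ω → G} {ψ : Vertex → ℕ → Ω → ℝ}

/-- The label at time `a` is a sample selected by the clock, so it has law `q` independently of the
event that the clock is silent on `[a, b]`; silence has probability at least `s` by the bound for a
ring in a short interval. -/
lemma isStaticEdges (h : IsDynamicalBRW P q μ N X ψ) {a b T s : ℝ} (hab : a ≤ b) (hbT : b ≤ T)
    (hs : (clockBound T).toReal * (b - a) ≤ 1 - s) :
    IsStaticEdges P q N X ψ (notRefreshed ψ a b)
      (fun v ω => refreshed (fun j => X v j ω) (fun j => ψ v j ω) a) s := by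
  have hclock : ∀ {S : Set Source} (v : Vertex), (∀ j, Sum.inr (Sum.inr (v, j)) ∈ S) →
      MeasurableSet[info N X ψ S] (notRefreshed ψ a b v) := by
    intro S v hv
    refine MeasurableSet.compl ?_
    have : {ω | ∃ j, ψ v (j + 1) ω ∈ Set.Icc a b} = ⋃ j, ψ v (j + 1) ⁻¹' Set.Icc a b := by
      ext ω; simp
    rw [this]
    exact MeasurableSet.iUnion fun j => h.measurable_clock_info (fun i _ => hv i) measurableSet_Icc
  have hindex : ∀ {S : Set Source} (v : Vertex), (∀ j, Sum.inr (Sum.inr (v, j)) ∈ S) →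
      Measurable[info N X ψ S] (fun ω => sInf {j : ℕ | a < ψ v j ω}) := fun v hv =>
    h.measurable_index measurable_const hv
  refine ⟨fun v => hclock v fun j => ⟨j, Or.inr rfl⟩, fun v => ?_, fun v g => ?_⟩
  · exact measurable_selected (fun j => measurable_sample_info ⟨j, Or.inl rfl⟩)
      (hindex v fun j => ⟨j, Or.inr rfl⟩)
  · have hmem : ∀ j, (Sum.inr (Sum.inr (v, j)) : Source) ∈ clockSources := fun j => ⟨(v, j), rfl⟩
    have hsel := h.measure_inter_selected (T := clockSources) (v := v)
      (by rintro j ⟨p, hp⟩; cases hp) (hindex v hmem) (hclock v hmem) g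
    have hreal : P.real (notRefreshed ψ a b v ∩
        {ω | refreshed (fun j => X v j ω) (fun j => ψ v j ω) a = g}) =
          P.real (notRefreshed ψ a b v) * (q g).toReal := by
      rw [Measure.real, Measure.real, ← ENNReal.toReal_mul]
      exact congrArg ENNReal.toReal hsel
    rw [hreal]
    gcongr
    have hm : MeasurableSet {ω | ∃ j, ψ v (j + 1) ω ∈ Set.Icc a b} := by
      have := h.info_le _ _ (hclock v hmem)
      simpa [notRefreshed] using this.compl
    rw [notRefreshed, probReal_compl_eq_one_sub hm]
    have hle : P.real {ω | ∃ j, ψ v (j + 1) ω ∈ Set.Icc a b} ≤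
        (clockBound T).toReal * (b - a) := by
      have h1 : P {ω | ∃ j, ψ v (j + 1) ω ∈ Set.Icc a b} ≤
          clockBound T * ENNReal.ofReal (b - a) :=
        (h.measure_exists_clock_mem_Icc_le v a b).trans (by gcongr; exact clockBound_mono hbT)
      have h2 := ENNReal.toReal_mono
        (ENNReal.mul_ne_top (clockBound_ne_top T) ENNReal.ofReal_ne_top) h1
      rwa [ENNReal.toReal_mul, ENNReal.toReal_ofReal (sub_nonneg.2 hab)] at h2
    linarith

end IsDynamicalBRW

/-! ### The supercritical phase -/

/-- Above the inverse of the spectral radius, the expected number of returns at some generation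
exceeds one, with room to spare. -/
lemma exists_supercritical_generation {G : Type*} [Group G] {q : PMF G} {m : ℝ≥0∞}
    (hm : 1 / rho q < m) :
    ∃ r s : ℝ, ∃ n : ℕ, 0 < r ∧ ENNReal.ofReal r < m ∧ 0 < s ∧ s < 1 ∧ n ≠ 0 ∧
      1 ≤ (r * s) ^ n * (stepProb q n 1 1).toReal := by
  rw [rho, one_div, inv_inv] at hm
  -- Choose `1/ρ < r' < r < m` and `s = r' / r`, so that `r * s = r'`. Beyond the radius of
  -- convergence the terms `p⁽ⁿ⁾(e,e) r'ⁿ` are unbounded, and one exceeding `1` cannot have `n = 0`.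
  obtain ⟨r, hr1, hr2⟩ := ENNReal.lt_iff_exists_nnreal_btwn.1 hm
  obtain ⟨r', hr'1, hr'2⟩ := ENNReal.lt_iff_exists_nnreal_btwn.1 hr1
  have hr'r : r' < r := by exact_mod_cast hr'2
  have hr'0 : 0 < r' := by
    have := lt_of_le_of_lt zero_le hr'1
    exact_mod_cast this
  have hr0 : 0 < r := hr'0.trans hr'r
  have hex : ∃ n : ℕ, 1 < (stepProb q n 1 1).toReal * (r' : ℝ) ^ n := by
    by_contra! hcon
    refine absurd ((genFun q 1 1).le_radius_of_bound 1 (r := r') fun n => ?_) (not_le.2 hr'1)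
    refine le_trans ?_ (hcon n)
    gcongr
    rw [genFun, FormalMultilinearSeries.ofScalars_norm]
    simp
  obtain ⟨n, hn⟩ := hex
  refine ⟨r, r' / r, n, by exact_mod_cast hr0, by simpa using hr2, by positivity, ?_, ?_, ?_⟩
  · rw [div_lt_one (by exact_mod_cast hr0)]
    exact_mod_cast hr'r
  · rintro rfl
    simp [stepProb_zero_self] at hn
  · rw [mul_div_cancel₀ _ (by exact_mod_cast hr0.ne'), mul_comm]
    exact hn.le

/-- If the mean offspring exceeds the inverse of the spectral radius, then almost surely there are
infinitely many visits to the identity at all times. -/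
theorem IsDynamicalBRW.ae_visits_eq_top {G : Type*} [Group G] [Countable G] [MeasurableSpace G]
    [DiscreteMeasurableSpace G] {S : Finset G} {q : PMF G} (hqS : q.support ⊆ (S : Set G))
    (hq : IsIrreducibleWalk q) {μ : PMF ℕ} (hμ0 : μ 0 = 0)
    {Ω : Type*} [MeasurableSpace Ω] {P : Measure Ω} [IsProbabilityMeasure P]
    {N : Vertex → Ω → ℕ} {X : Vertex → ℕ → Ω → G} {ψ : Vertex → ℕ → Ω → ℝ}
    (h : IsDynamicalBRW P q μ N X ψ) (hm : 1 / rho q < offspringMean μ) :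
    ∀ᵐ ω ∂P, ∀ t : ℝ, 0 ≤ t →
      visits (fun v => N v ω) (fun v j => X v j ω) (fun v j => ψ v j ω) t = ⊤ := by
  obtain ⟨r, s, n, hr0, hr, hs0, hs1, hn0, hn⟩ := exists_supercritical_generation hm
  have hshort : ∀ a b T : ℝ, 0 ≤ a → a ≤ b → b ≤ T → (clockBound T).toReal * (b - a) ≤ 1 - s →
      ∀ᵐ ω ∂P, ∀ t : ℝ, a ≤ t → t ≤ b →
        visits (fun v => N v ω) (fun v j => X v j ω) (fun v j => ψ v j ω) t = ⊤ := by
    intro a b T ha hab hbT hle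
    have hstatic := h.isStaticEdges hab hbT hle
    obtain ⟨x, hx0, hx⟩ := h.exists_le_measure_recurrentAt hstatic hs0 hs1.le hqS hq hr0 hr hn0 hn
    filter_upwards [h.ae_exists_recurrentAt hstatic hμ0 hx0 hx] with ω hω t hat htb
    obtain ⟨u, hu, hrec⟩ := hω
    exact visits_eq_top (B := notRefreshed ψ a b)
      (Y := fun v ω => refreshed (fun j => X v j ω) (fun j => ψ v j ω) a)
      (fun v hv => refreshed_eq_of_notRefreshed _ (h.clock_zero v ω) ha hat htb hv) hu hrec
  -- The constant is taken at `T + 1` because the cell of mesh `1 / M` that contains a time `t ≤ T`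
  -- may extend beyond `T`.
  have hmesh : ∀ T : ℕ, ∃ M : ℕ, 0 < M ∧ (clockBound (T + 1)).toReal * (1 / M) ≤ 1 - s := by
    intro T
    obtain ⟨M, hM⟩ := exists_nat_gt ((clockBound (T + 1)).toReal / (1 - s))
    have hM0 : (0 : ℝ) < M := lt_of_le_of_lt (div_nonneg ENNReal.toReal_nonneg (by linarith)) hM
    refine ⟨M, by exact_mod_cast hM0, ?_⟩
    rw [div_lt_iff₀ (by linarith)] at hM
    rw [mul_one_div, div_le_iff₀ hM0]
    linarith
  choose M hM0 hM using hmesh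
  have hcell : ∀ T k : ℕ, ∀ᵐ ω ∂P, ((k : ℝ) + 1) / M T ≤ T + 1 → ∀ t : ℝ, (k : ℝ) / M T ≤ t →
      t ≤ ((k : ℝ) + 1) / M T →
        visits (fun v => N v ω) (fun v j => X v j ω) (fun v j => ψ v j ω) t = ⊤ := by
    intro T k
    by_cases hk : ((k : ℝ) + 1) / M T ≤ T + 1
    · have hdiff : ((k : ℝ) + 1) / M T - k / M T = 1 / M T := by ring
      filter_upwards [hshort (k / M T) ((k + 1) / M T) (T + 1) (by positivity)
        (by gcongr; linarith) hk (by rw [hdiff]; exact hM T)] with ω hω _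
      exact hω
    · exact ae_of_all _ fun _ hk' => absurd hk' hk
  filter_upwards [ae_all_iff.2 fun T => ae_all_iff.2 (hcell T)] with ω hω t ht
  obtain ⟨T, hT⟩ := exists_nat_ge t
  have hMT : (0 : ℝ) < M T := by exact_mod_cast hM0 T
  have hMT1 : (1 : ℝ) ≤ M T := by exact_mod_cast hM0 T
  have hfl := Nat.floor_le (mul_nonneg ht hMT.le)
  have hlt := Nat.lt_floor_add_one (t * M T)
  refine hω T ⌊t * M T⌋₊ ?_ t ?_ ?_
  · rw [div_le_iff₀ hMT]
    nlinarith
  · rwa [div_le_iff₀ hMT]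
  · rw [le_div_iff₀ hMT]
    exact hlt.le

end DynBRW

open DynBRW in
theorem theorem2 {G : Type*} [Group G] [MeasurableSpace G] [DiscreteMeasurableSpace G]
    (S : Finset G) (hS : Subgroup.closure (S : Set G) = ⊤)
    (q : PMF G) (hqS : q.support ⊆ (S : Set G)) (hq : IsIrreducibleWalk q)
    (μ : PMF ℕ) (hμ0 : μ 0 = 0) (hμ1 : 1 < offspringMean μ)
    {Ω : Type*} [MeasurableSpace Ω] (P : Measure Ω) [IsProbabilityMeasure P]
    (N : Vertex → Ω → ℕ) (X : Vertex → ℕ → Ω → G) (ψ : Vertex → ℕ → Ω → ℝ)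
    (h : IsDynamicalBRW P q μ N X ψ) :
    (offspringMean μ ≤ 1 / rho q →
      ∑' n : ℕ, (n : ℝ≥0∞) * stepProb q n 1 1 * offspringMean μ ^ n < ∞ →
      ∀ᵐ ω ∂P, ∀ t : ℝ, 0 ≤ t →
        visits (fun v => N v ω) (fun v j => X v j ω) (fun v j => ψ v j ω) t < ⊤) ∧
    (1 / rho q < offspringMean μ →
      ∀ᵐ ω ∂P, ∀ t : ℝ, 0 ≤ t →
        visits (fun v => N v ω) (fun v j => X v j ω) (fun v j => ψ v j ω) t = ⊤) := by
  have := countable_of_closure_eq_top hS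
  exact ⟨fun _ hsum => h.ae_visits_lt_top hsum, fun hm => h.ae_visits_eq_top hqS hq hμ0 hm⟩
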